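/- Let $0<p<1$. Let $\{G_n\}_{n\ge 1}$ be a graph process on a probability space that follows the Superstar Model with parameter $p$: $G_1$ is the single vertex $v_0$ (the superstar), $G_2$ consists of $v_0$, $v_1$ and the edge between them, and for each $n\ge 2$, given $G_1,\dots,G_n$, the graph $G_{n+1}$ is obtained from $G_n$ by adding a new vertex $v_n$ and one edge from $v_n$ to one of $v_0,\dots,v_{n-1}$; this edge goes to $v_0$ with conditional probability $p$, and to $v_i$, $1\le i\le n-1$, with conditional probability $$(1-p)\,\frac{\deg(v_i,G_n)}{\sum_{j=1}^{n-1}\deg(v_j,G_n)}.$$ Let $\Upsilon_n=\max_{1\le i\le n}\deg(v_i,G_n)$, where $\deg(v_n,G_n)=0$ since $v_n$ is not yet a vertex of $G_n$, and let $\gamma=\frac{1-p}{2-p}$. Then there is a finite, almost surely strictly positive random variable $\Delta^*$ on the same probability space that is non-degenerate (i.e. not almost surely equal to a constant) such that $$\lim_{n\to\infty} n^{-\gamma}\,\Upsilon_n=\Delta^*\qquad\text{almost surely.}$$ -/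

import Mathlib

open MeasureTheory Filter Topology

namespace Superstar

/-- The degree of the vertex `v` in the graph `H` (with vertex labels in `ℕ`), that is, its number
of neighbours. It agrees with `SimpleGraph.degree`, see `vdeg_eq_degree`. -/
noncomputable def vdeg (H : SimpleGraph ℕ) (v : ℕ) : ℕ := (H.neighborSet v).ncard

theorem vdeg_eq_degree (H : SimpleGraph ℕ) (v : ℕ) [Fintype (H.neighborSet v)] :
    vdeg H v = H.degree v := by
  rw [vdeg, Set.ncard_eq_toFinset_card', SimpleGraph.degree, SimpleGraph.neighborFinset]

/-- The probability that the new vertex `v_n` attaches to `v_i`, `i < n`, when the current graph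
on `v_0, …, v_{n-1}` is `H`: it attaches to the superstar `v_0` with probability `p`, and with
probability `1 - p` to one of the vertices `v_1, …, v_{n-1}`, chosen proportionally to its degree
in `H`. -/
noncomputable def attachProb (p : ℝ) (H : SimpleGraph ℕ) (n i : ℕ) : ℝ :=
  if i = 0 then p
  else (1 - p) * ((vdeg H i : ℝ) / ∑ j ∈ Finset.Ico 1 n, (vdeg H j : ℝ))

/-- `G 1, G 2, …` is a graph process that follows the Superstar Model with parameter `p`.
The vertex `v_i` is the label `i`. The graph `G n` lives on the `n` vertices `v_0, …, v_{n-1}`;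
the labels `i ≥ n` (vertices not yet born) are isolated in `G n`.
(The value `G 0` is irrelevant.) -/
structure IsSuperstarProcess {Ω : Type*} [MeasurableSpace Ω] (μ : Measure Ω) (p : ℝ)
    (G : ℕ → Ω → SimpleGraph ℕ) : Prop where
  /-- Each `G n` is a (discrete) random graph. -/
  measurableSet_eq : ∀ (n : ℕ) (H : SimpleGraph ℕ), MeasurableSet {ω | G n ω = H}
  /-- `G 1` is the single vertex `v_0`, without edges. -/
  init_one : ∀ᵐ ω ∂μ, G 1 ω = ⊥
  /-- `G 2` consists of `v_0`, `v_1` and the edge between them. -/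
  init_two : ∀ᵐ ω ∂μ, G 2 ω = SimpleGraph.edge 0 1
  /-- For `n ≥ 2`, given that the history `(G 1, …, G n)` equals `(H 1, …, H n)`, the graph
  `G (n + 1)` is `H n` together with an edge from the new vertex `v_n` to `v_i` with probability
  `attachProb p (H n) n i`, for each `i < n`. -/
  step : ∀ n : ℕ, 2 ≤ n → ∀ (H : ℕ → SimpleGraph ℕ) (i : ℕ), i < n →
    μ {ω | (∀ k ∈ Finset.Icc 1 n, G k ω = H k) ∧ G (n + 1) ω = H n ⊔ SimpleGraph.edge i n} =
      ENNReal.ofReal (attachProb p (H n) n i) * μ {ω | ∀ k ∈ Finset.Icc 1 n, G k ω = H k}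

/-- The maximal non-superstar degree `max_{1 ≤ i ≤ n} deg(v_i, H)`. -/
noncomputable def maxDeg (n : ℕ) (H : SimpleGraph ℕ) : ℕ :=
  (Finset.Icc 1 n).sup fun i => vdeg H i

end Superstar

/-! The process is encoded by the sequence `f` of parents of $v_2,v_3,\dots$. Let $w_k$ (`wt`) be
the sum of the non-superstar degrees after $k$ steps. Given the past, a vertex of degree $D$ gains
an edge with probability $(1-p)D/w_k$. If $D(g(D+1)-g(D))=r\,g(D)$, then $g(\deg)$ divided by
$\prod_k(1+r(1-p)/w_k)$ (`grow`) is therefore a martingale; the normalization may be random because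
its $k$-th factor is known before step $k$. Three choices of $g$ carry the proof.

With $g(D)=D$, $r=1$, the normalized maximum `normMax` is a submartingale. With $g$ the rising
factorial of an order $r\ge 4/(1-p)$, the sum over all vertices has bounded mean: existing vertices
contribute martingales and new ones a summable amount. It dominates `normMax ^ r`, so `normMax` is
bounded in $L^1$ and converges (`exists_tendsto_normMax`). With $g(D)\approx D^{-1/2}$, $r=-1/2$, a
nonnegative martingale of the degree of $v_1$ would blow up if `normMax` tended to 0, which Fatou's
lemma excludes (`not_tendsto_normMax_zero`).

The increments of $w_k$ are independent of the past, equal to 1 or 2 with mean $2-p$. A second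
moment bound shows $\sum_k|(1-p)/w_k-\gamma/(k+1)|<\infty$, so `grow` with $r=1$ is asymptotic to a
positive random multiple of $n^\gamma$ (`tendsto_grow_div`).

For non-degeneracy, consider the event of positive probability that the first $N$ new vertices all
choose the superstar. At its end all other degrees are 1, and the same moment bounds, restarted at
time $N$, show that with positive probability the limit, if it is a constant $c$, satisfies $c^r\le
C/(N+1)$ with $C$ independent of $N$. Hence no positive constant can be the limit
(`not_ae_tendsto_const`). -/

namespace Superstar

/-! ### Degrees along a parent sequence, one-step averages and the martingale normalization. -/

section

/-- The degree of `v_i` after `k` steps, when the vertex `v_{j+2}` attaches to `v_{f j}`. -/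
def pdeg (f : ℕ → ℕ) : ℕ → ℕ → ℕ
  | 0, i => if i ≤ 1 then 1 else 0
  | k + 1, i => pdeg f k i + (if f k = i ∧ i < k + 2 then 1 else 0) + if i = k + 2 then 1 else 0

/-- The sum of the degrees of all vertices but the superstar after `k` steps. -/
def wt (f : ℕ → ℕ) (k : ℕ) : ℕ := ∑ i ∈ Finset.Ico 1 (k + 2), pdeg f k i

/-- The maximal degree of a vertex other than the superstar after `k` steps. -/
def pmax (f : ℕ → ℕ) (k : ℕ) : ℕ := (Finset.Icc 1 (k + 2)).sup (pdeg f k)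

/-- The probability that `v_{k+2}` attaches to `v_i`. -/
noncomputable def parentProb (p : ℝ) (f : ℕ → ℕ) (k i : ℕ) : ℝ :=
  if i = 0 then p else (1 - p) * ((pdeg f k i : ℝ) / (wt f k : ℝ))

/-- The average of `φ` over the choice of the parent of `v_{k+2}`. -/
noncomputable def avg (p : ℝ) (k : ℕ) (φ : (ℕ → ℕ) → ℝ) (f : ℕ → ℕ) : ℝ :=
  ∑ i ∈ Finset.range (k + 2), parentProb p f k i * φ (Function.update f k i)

/-- `φ` depends only on the first `k` terms of the sequence. -/
def DepOn {α : Type*} (k : ℕ) (φ : (ℕ → ℕ) → α) : Prop :=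
  ∀ f g : ℕ → ℕ, (∀ j < k, f j = g j) → φ f = φ g

theorem DepOn.mono {α : Type*} {k l : ℕ} (h : k ≤ l) {φ : (ℕ → ℕ) → α} (hφ : DepOn k φ) :
    DepOn l φ := fun f g hfg => hφ f g fun j hj => hfg j (hj.trans_le h)

theorem DepOn.comp {α β : Type*} {k : ℕ} {φ : (ℕ → ℕ) → α} (hφ : DepOn k φ) (F : α → β) :
    DepOn k fun f => F (φ f) := fun f g hfg => congrArg F (hφ f g hfg)

theorem DepOn.comp₂ {α β γ : Type*} {k : ℕ} {φ : (ℕ → ℕ) → α} {ψ : (ℕ → ℕ) → β}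
    (hφ : DepOn k φ) (hψ : DepOn k ψ) (F : α → β → γ) :
    DepOn k fun f => F (φ f) (ψ f) := fun f g hfg => by
  simp only [hφ f g hfg, hψ f g hfg]

theorem depOn_pdeg (k : ℕ) : DepOn k fun f => pdeg f k := by
  induction k with
  | zero => intro f g _; funext i; simp [pdeg]
  | succ k ih =>
    intro f g hfg
    funext i
    have h := congrFun (ih f g fun j hj => hfg j (by omega)) i
    simp only at h
    simp only [pdeg, h, hfg k (by omega)]

theorem depOn_wt (k : ℕ) : DepOn k fun f => wt f k :=
  (depOn_pdeg k).comp fun d => ∑ i ∈ Finset.Ico 1 (k + 2), d i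

theorem depOn_pmax (k : ℕ) : DepOn k fun f => pmax f k :=
  (depOn_pdeg k).comp fun d => (Finset.Icc 1 (k + 2)).sup d

theorem pdeg_update (f : ℕ → ℕ) (k i j : ℕ) : pdeg (Function.update f k i) (k + 1) j =
    pdeg f k j + (if i = j ∧ j < k + 2 then 1 else 0) + if j = k + 2 then 1 else 0 := by
  have h := congrFun (depOn_pdeg k (Function.update f k i) f fun l hl =>
    Function.update_of_ne (by omega) _ _) j
  simp only at h
  simp only [pdeg, h, Function.update_self]

theorem pdeg_eq_zero (f : ℕ → ℕ) {k i : ℕ} (h : k + 2 ≤ i) : pdeg f k i = 0 := by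
  induction k with
  | zero => simp only [pdeg]; rw [if_neg (by omega)]
  | succ k ih =>
    simp only [pdeg]
    rw [ih (by omega), if_neg (by omega), if_neg (by omega)]

theorem pdeg_pos (f : ℕ → ℕ) {k i : ℕ} (h : i < k + 2) : 1 ≤ pdeg f k i := by
  induction k with
  | zero => simp only [pdeg]; rw [if_pos (by omega)]
  | succ k ih =>
    simp only [pdeg]
    rcases Nat.lt_or_ge i (k + 2) with h' | h'
    · have := ih h'; omega
    · rw [if_pos (show i = k + 2 by omega)]; omega

theorem wt_zero (f : ℕ → ℕ) : wt f 0 = 1 := by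
  rw [wt, Finset.sum_Ico_succ_top (by omega)]; simp [pdeg]

theorem wt_succ (f : ℕ → ℕ) (k : ℕ) :
    wt f (k + 1) = wt f k + 1 + if f k ∈ Finset.Ico 1 (k + 2) then 1 else 0 := by
  have h1 : pdeg f (k + 1) (k + 2) = 1 := by
    simp [pdeg, pdeg_eq_zero f (le_refl (k + 2))]
  have h2 : ∑ i ∈ Finset.Ico 1 (k + 2), pdeg f (k + 1) i =
      ∑ i ∈ Finset.Ico 1 (k + 2), (pdeg f k i + if f k = i then 1 else 0) := by
    refine Finset.sum_congr rfl fun i hi => ?_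
    have := (Finset.mem_Ico.1 hi).2
    simp only [pdeg, this, and_true]
    rw [if_neg (show i ≠ k + 2 by omega), add_zero]
  unfold wt
  rw [show k + 1 + 2 = (k + 2) + 1 by ring, Finset.sum_Ico_succ_top (by omega), h1, h2,
    Finset.sum_add_distrib, Finset.sum_ite_eq]
  ring

theorem le_wt (f : ℕ → ℕ) (k : ℕ) : k + 1 ≤ wt f k := by
  induction k with
  | zero => simp [wt_zero]
  | succ k ih => rw [wt_succ]; omega

theorem wt_le (f : ℕ → ℕ) (k : ℕ) : wt f k ≤ 2 * k + 1 := by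
  induction k with
  | zero => simp [wt_zero]
  | succ k ih => rw [wt_succ]; split_ifs <;> omega

theorem wt_pos (f : ℕ → ℕ) (k : ℕ) : (0 : ℝ) < wt f k := by
  have := le_wt f k
  exact_mod_cast (by omega : 0 < wt f k)

theorem wt_update (f : ℕ → ℕ) {k i : ℕ} (hi : i < k + 2) :
    wt (Function.update f k i) (k + 1) = wt f k + 1 + if i = 0 then 0 else 1 := by
  have h : wt (Function.update f k i) k = wt f k := depOn_wt k (Function.update f k i) f fun l hl =>
    Function.update_of_ne (by omega) _ _
  rw [wt_succ, h, Function.update_self]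
  simp only [Finset.mem_Ico]
  split_ifs <;> omega

theorem pdeg_le_wt (f : ℕ → ℕ) {k i : ℕ} (h1 : 1 ≤ i) : pdeg f k i ≤ wt f k := by
  rcases Nat.lt_or_ge i (k + 2) with h | h
  · exact Finset.single_le_sum (f := pdeg f k) (fun _ _ => Nat.zero_le _) (Finset.mem_Ico.2 ⟨h1, h⟩)
  · rw [pdeg_eq_zero f h]; exact Nat.zero_le _

theorem pmax_le_wt (f : ℕ → ℕ) (k : ℕ) : pmax f k ≤ wt f k :=
  Finset.sup_le fun _ hi => pdeg_le_wt f (Finset.mem_Icc.1 hi).1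

theorem pdeg_le_pmax (f : ℕ → ℕ) {k i : ℕ} (h1 : 1 ≤ i) : pdeg f k i ≤ pmax f k := by
  rcases Nat.lt_or_ge i (k + 2) with h | h
  · exact Finset.le_sup (f := pdeg f k) (Finset.mem_Icc.2 ⟨h1, h.le⟩)
  · rw [pdeg_eq_zero f h]; exact Nat.zero_le _

theorem exists_pdeg_eq_pmax (f : ℕ → ℕ) (k : ℕ) :
    ∃ i ∈ Finset.Ico 1 (k + 2), pdeg f k i = pmax f k := by
  obtain ⟨i, hi, h⟩ := Finset.exists_mem_eq_sup (Finset.Icc 1 (k + 2)) ⟨1, by simp⟩ (pdeg f k)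
  -- The supremum includes the unborn label `k + 2`, of degree 0; since $v_1$ has degree at least 1,
  -- the maximum sits at a born vertex.
  have h1 : 1 ≤ pdeg f k 1 := pdeg_pos f (by omega)
  have h2 : pdeg f k 1 ≤ pmax f k := pdeg_le_pmax f le_rfl
  refine ⟨i, Finset.mem_Ico.2 ⟨(Finset.mem_Icc.1 hi).1, ?_⟩, h.symm⟩
  by_contra! h3
  have := pdeg_eq_zero f h3
  unfold pmax at h2
  omega

variable {p : ℝ}

theorem parentProb_nonneg (hp0 : 0 < p) (hp1 : p < 1) (f : ℕ → ℕ) (k i : ℕ) :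
    0 ≤ parentProb p f k i := by
  unfold parentProb
  split_ifs
  · exact hp0.le
  · exact mul_nonneg (by linarith) (by positivity)

theorem sum_range_eq_add_Ico (k : ℕ) (F : ℕ → ℝ) :
    ∑ i ∈ Finset.range (k + 2), F i = F 0 + ∑ i ∈ Finset.Ico 1 (k + 2), F i := by
  rw [Finset.range_eq_Ico, Finset.sum_eq_sum_Ico_succ_bot (by omega)]

theorem sum_Ico_parentProb (p : ℝ) (f : ℕ → ℕ) (k : ℕ) :
    ∑ i ∈ Finset.Ico 1 (k + 2), parentProb p f k i = 1 - p := by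
  have h : ∀ i ∈ Finset.Ico 1 (k + 2), parentProb p f k i =
      (1 - p) / wt f k * (pdeg f k i : ℝ) := fun i hi => by
    rw [parentProb, if_neg (by have := Finset.mem_Ico.1 hi; omega)]; ring
  rw [Finset.sum_congr rfl h, ← Finset.mul_sum, ← Nat.cast_sum]
  exact div_mul_cancel₀ _ (wt_pos f k).ne'

theorem sum_parentProb (p : ℝ) (f : ℕ → ℕ) (k : ℕ) :
    ∑ i ∈ Finset.range (k + 2), parentProb p f k i = 1 := by
  rw [sum_range_eq_add_Ico, sum_Ico_parentProb, parentProb, if_pos rfl]; ring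

theorem depOn_avg (p : ℝ) (k : ℕ) {φ : (ℕ → ℕ) → ℝ} (hφ : DepOn (k + 1) φ) :
    DepOn k (avg p k φ) := by
  intro f g hfg
  have h1 := depOn_pdeg k f g hfg
  have h2 := depOn_wt k f g hfg
  simp only at h1 h2
  unfold avg parentProb
  refine Finset.sum_congr rfl fun i _ => ?_
  rw [h1, h2]
  congr 1
  refine hφ _ _ fun j hj => ?_
  rcases eq_or_ne j k with rfl | h
  · simp
  · rw [Function.update_of_ne h, Function.update_of_ne h, hfg j (by omega)]

/-- The average of a function of the degree of an existing vertex. -/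
theorem avg_pdeg (p : ℝ) (f : ℕ → ℕ) {k j : ℕ} (h1 : 1 ≤ j) (h2 : j < k + 2) (g : ℕ → ℝ) :
    avg p k (fun f => g (pdeg f (k + 1) j)) f =
      g (pdeg f k j) + (1 - p) / wt f k * (pdeg f k j * (g (pdeg f k j + 1) - g (pdeg f k j))) := by
  have h : ∀ i ∈ Finset.range (k + 2),
      parentProb p f k i * g (pdeg (Function.update f k i) (k + 1) j) =
        parentProb p f k i * g (pdeg f k j) +
          if j = i then parentProb p f k i * (g (pdeg f k j + 1) - g (pdeg f k j)) else 0 := by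
    intro i _
    rw [pdeg_update]
    rcases eq_or_ne i j with rfl | hij
    · rw [if_pos ⟨rfl, h2⟩, if_neg h2.ne, if_pos rfl]; simp only [add_zero]; ring
    · rw [if_neg (by tauto), if_neg h2.ne, if_neg hij.symm]; simp
  unfold avg
  rw [Finset.sum_congr rfl h, Finset.sum_add_distrib, ← Finset.sum_mul, sum_parentProb,
    Finset.sum_ite_eq, if_pos (Finset.mem_range.2 h2), parentProb, if_neg (by omega)]
  ring

/-- The weight grows by 1 if the superstar is chosen and by 2 otherwise, whatever the degrees, so it
is a random walk by itself. -/
theorem avg_wt (p : ℝ) (f : ℕ → ℕ) (k : ℕ) (h : ℕ → ℝ) :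
    avg p k (fun f => h (wt f (k + 1))) f =
      p * h (wt f k + 1) + (1 - p) * h (wt f k + 2) := by
  unfold avg
  rw [sum_range_eq_add_Ico]
  beta_reduce
  rw [wt_update f (by omega)]
  have : ∀ i ∈ Finset.Ico 1 (k + 2),
      parentProb p f k i * h (wt (Function.update f k i) (k + 1)) =
        parentProb p f k i * h (wt f k + 2) := by
    intro i hi
    have := Finset.mem_Ico.1 hi
    rw [wt_update f this.2, if_neg (by omega)]
  rw [Finset.sum_congr rfl this, ← Finset.sum_mul, sum_Ico_parentProb]
  simp [parentProb]

/-- A factor that does not depend on the new parent can be taken out of the average. -/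
theorem avg_mul (p : ℝ) (f : ℕ → ℕ) {k : ℕ} {c : (ℕ → ℕ) → ℝ} (hc : DepOn k c)
    (φ : (ℕ → ℕ) → ℝ) : avg p k (fun f => c f * φ f) f = c f * avg p k φ f := by
  unfold avg
  rw [Finset.mul_sum]
  refine Finset.sum_congr rfl fun i _ => ?_
  beta_reduce
  rw [hc (Function.update f k i) f fun l hl => Function.update_of_ne (by omega) _ _]
  ring

theorem avg_sum (p : ℝ) (f : ℕ → ℕ) (k : ℕ) {ι : Type*} (s : Finset ι) (φ : ι → (ℕ → ℕ) → ℝ) :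
    avg p k (fun f => ∑ j ∈ s, φ j f) f = ∑ j ∈ s, avg p k (φ j) f := by
  unfold avg
  rw [Finset.sum_comm]
  exact Finset.sum_congr rfl fun i _ => Finset.mul_sum _ _ _

theorem avg_mono (hp0 : 0 < p) (hp1 : p < 1) (f : ℕ → ℕ) (k : ℕ) {φ ψ : (ℕ → ℕ) → ℝ}
    (h : ∀ f, φ f ≤ ψ f) : avg p k φ f ≤ avg p k ψ f :=
  Finset.sum_le_sum fun i _ => mul_le_mul_of_nonneg_left (h _) (parentProb_nonneg hp0 hp1 f k i)

theorem avg_add (p : ℝ) (f : ℕ → ℕ) (k : ℕ) (φ ψ : (ℕ → ℕ) → ℝ) :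
    avg p k (fun f => φ f + ψ f) f = avg p k φ f + avg p k ψ f := by
  unfold avg
  rw [← Finset.sum_add_distrib]
  exact Finset.sum_congr rfl fun i _ => by ring

theorem avg_of_depOn (p : ℝ) (f : ℕ → ℕ) {k : ℕ} {c : (ℕ → ℕ) → ℝ} (hc : DepOn k c) :
    avg p k c f = c f := by
  have h := avg_mul p f hc fun _ => 1
  simp only [mul_one] at h
  rw [h, avg]
  simp [sum_parentProb]

/-- The expected growth between the times `N` and `n` of a quantity that grows at each step by
`r / D` times itself with probability `(1 - p) D / wt`. -/
noncomputable def grow (p r : ℝ) (f : ℕ → ℕ) (N n : ℕ) : ℝ :=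
  ∏ k ∈ Finset.Ico N n, (1 + r * ((1 - p) / wt f k))

/-- Predictability: the last factor only involves `wt f n`, so the normalization at time `n + 1` can
be pulled out of the average over the `n`-th parent. -/
theorem depOn_grow (p r : ℝ) (N n : ℕ) : DepOn n fun f => grow p r f N (n + 1) := by
  intro f g hfg
  refine Finset.prod_congr rfl fun k hk => ?_
  have h : wt f k = wt g k := depOn_wt k f g fun j hj => hfg j (by
    have := Finset.mem_Ico.1 hk; omega)
  rw [h]

theorem grow_self (p r : ℝ) (f : ℕ → ℕ) (N : ℕ) : grow p r f N N = 1 := by simp [grow]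

theorem grow_succ (p r : ℝ) (f : ℕ → ℕ) {N n : ℕ} (h : N ≤ n) :
    grow p r f N (n + 1) = grow p r f N n * (1 + r * ((1 - p) / wt f n)) :=
  Finset.prod_Ico_succ_top h _

theorem depOn_grow' (p r : ℝ) (N n : ℕ) : DepOn n fun f => grow p r f N n := by
  cases n with
  | zero => intro f g _; simp [grow]
  | succ n => exact (depOn_grow p r N n).mono n.le_succ

theorem rate_pos (hp1 : p < 1) (f : ℕ → ℕ) (k : ℕ) : 0 < (1 - p) / wt f k :=
  div_pos (by linarith) (wt_pos f k)

theorem rate_le (hp0 : 0 < p) (f : ℕ → ℕ) (k : ℕ) : (1 - p) / wt f k ≤ 1 / (k + 1) := by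
  have h : ((k : ℝ) + 1) ≤ wt f k := by exact_mod_cast le_wt f k
  exact div_le_div₀ zero_le_one (by linarith) (by positivity) h

theorem growFactor_pos (hp0 : 0 < p) (hp1 : p < 1) {r : ℝ} (hr : -1 < r) (f : ℕ → ℕ) (k : ℕ) :
    0 < 1 + r * ((1 - p) / wt f k) := by
  have h1 := rate_pos hp1 f k
  have h2 : (1 - p) / wt f k ≤ 1 := (rate_le hp0 f k).trans
    (div_le_one_of_le₀ (by linarith [k.cast_nonneg (α := ℝ)]) (by positivity))
  nlinarith

theorem grow_pos (hp0 : 0 < p) (hp1 : p < 1) {r : ℝ} (hr : -1 < r) (f : ℕ → ℕ) (N n : ℕ) :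
    0 < grow p r f N n :=
  Finset.prod_pos fun k _ => growFactor_pos hp0 hp1 hr f k

/-- The martingale property of functions of a degree. -/
theorem avg_pdeg_div_grow (hp0 : 0 < p) (hp1 : p < 1) {r : ℝ} (hr : -1 < r) (f : ℕ → ℕ)
    {N k j : ℕ} (hN : N ≤ k) (h1 : 1 ≤ j) (h2 : j < k + 2) {g : ℕ → ℝ}
    (hg : ∀ D : ℕ, 1 ≤ D → D * (g (D + 1) - g D) = r * g D) :
    avg p k (fun f => g (pdeg f (k + 1) j) / grow p r f N (k + 1)) f =
      g (pdeg f k j) / grow p r f N k := by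
  have h := avg_mul p f ((depOn_grow p r N k).comp fun x => x⁻¹) fun f => g (pdeg f (k + 1) j)
  simp only [div_eq_inv_mul]
  rw [h, avg_pdeg p f h1 h2, hg _ (pdeg_pos f h2), grow_succ p r f hN]
  have h3 := growFactor_pos hp0 hp1 hr f k
  have h4 := grow_pos hp0 hp1 hr f N k
  rw [show g (pdeg f k j) + (1 - p) / wt f k * (r * g (pdeg f k j)) =
    g (pdeg f k j) * (1 + r * ((1 - p) / wt f k)) by ring]
  generalize 1 + r * ((1 - p) / wt f k) = x at h3 ⊢
  field_simp

end

/-! ### The law of the parent sequence and integration over past events. -/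

section

/-- `ν` is the law of the sequence of the parents of `v_2, v_3, …`. -/
structure IsPathLaw (ν : Measure (ℕ → ℕ)) (p : ℝ) : Prop where
  valid : ∀ᵐ f ∂ν, ∀ k, f k < k + 2
  step : ∀ (k : ℕ) (f : ℕ → ℕ) (i : ℕ), i < k + 2 →
    ν {g | (∀ j < k, g j = f j) ∧ g k = i} =
      ENNReal.ofReal (parentProb p f k i) * ν {g | ∀ j < k, g j = f j}

/-- The first `k` terms of a sequence. -/
def res (k : ℕ) (f : ℕ → ℕ) : Fin k → ℕ := fun j => f j

/-- The extension of a finite sequence by zeros. -/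
def ext (k : ℕ) (t : Fin k → ℕ) : ℕ → ℕ := fun j => if h : j < k then t ⟨j, h⟩ else 0

theorem ext_res {k : ℕ} (f : ℕ → ℕ) {j : ℕ} (h : j < k) : ext k (res k f) j = f j := by
  simp [ext, res, h]

theorem measurable_res (k : ℕ) : Measurable (res k) :=
  measurable_pi_lambda _ fun _ => measurable_pi_apply _

/-- The filtration of the first `k` parents. -/
def pathFiltration : Filtration ℕ (MeasurableSpace.pi : MeasurableSpace (ℕ → ℕ)) where
  seq k := MeasurableSpace.comap (res k) inferInstance
  mono' k l h := by
    have : res k = (fun (t : Fin l → ℕ) (j : Fin k) => t (Fin.castLE h j)) ∘ res l := by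
      funext f j; simp [res]
    beta_reduce
    rw [this, ← MeasurableSpace.comap_comp]
    exact MeasurableSpace.comap_mono
      (measurable_iff_comap_le.1 (measurable_pi_lambda _ fun _ => measurable_pi_apply _))
  le' k := measurable_iff_comap_le.1 (measurable_res k)

/-- Such a function factors through the countable discrete space `Fin k → ℕ`, where everything is
measurable. -/
theorem DepOn.measurable_filtration {α : Type*} [MeasurableSpace α] {k : ℕ} {φ : (ℕ → ℕ) → α}
    (hφ : DepOn k φ) : Measurable[pathFiltration k] φ := by
  have : φ = (φ ∘ ext k) ∘ res k := by
    funext f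
    exact hφ _ _ fun j hj => (ext_res f hj).symm
  rw [this]
  exact (Measurable.of_discrete (f := φ ∘ ext k)).comp (comap_measurable (res k))

theorem DepOn.measurable {α : Type*} [MeasurableSpace α] {k : ℕ} {φ : (ℕ → ℕ) → α}
    (hφ : DepOn k φ) : Measurable φ :=
  hφ.measurable_filtration.mono (pathFiltration.le k) le_rfl

theorem measurableSet_cylinder (k : ℕ) (f : ℕ → ℕ) : MeasurableSet {g : ℕ → ℕ | ∀ j < k, g j = f j} := by
  have : {g : ℕ → ℕ | ∀ j < k, g j = f j} = ⋂ j ∈ Set.Iio k, {g | g j = f j} := by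
    ext g; simp
  rw [this]
  exact MeasurableSet.biInter (Set.to_countable _) fun j _ =>
    measurableSet_eq_fun (measurable_pi_apply j) measurable_const

variable {p : ℝ} {ν : Measure (ℕ → ℕ)}

/-- The cylinder splits, up to a null set, according to the next parent; on each piece `φ` is
constant. Lower integrals avoid integrability conditions. -/
theorem lintegral_cylinder_step (hν : IsPathLaw ν p) (hp0 : 0 < p) (hp1 : p < 1) {k : ℕ}
    {φ : (ℕ → ℕ) → ℝ} (h0 : ∀ f, 0 ≤ φ f) (hφ : DepOn (k + 1) φ) (f : ℕ → ℕ) :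
    ∫⁻ g in {g | ∀ j < k, g j = f j}, ENNReal.ofReal (φ g) ∂ν =
      ∫⁻ g in {g | ∀ j < k, g j = f j}, ENNReal.ofReal (avg p k φ g) ∂ν := by
  have hR : ∫⁻ g in {g | ∀ j < k, g j = f j}, ENNReal.ofReal (avg p k φ g) ∂ν =
      ENNReal.ofReal (avg p k φ f) * ν {g | ∀ j < k, g j = f j} := by
    rw [← setLIntegral_const]
    refine setLIntegral_congr_fun (measurableSet_cylinder k f) fun g hg => ?_
    simp only [depOn_avg p k hφ g f hg]
  have hms : ∀ i ∈ Finset.range (k + 2),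
      MeasurableSet {g : ℕ → ℕ | (∀ j < k, g j = f j) ∧ g k = i} := fun i _ =>
    (measurableSet_cylinder k f).inter
      (measurableSet_eq_fun (measurable_pi_apply k) measurable_const)
  have hsets : ({g | ∀ j < k, g j = f j} : Set (ℕ → ℕ)) =ᵐ[ν]
      ⋃ i ∈ Finset.range (k + 2), {g | (∀ j < k, g j = f j) ∧ g k = i} := by
    filter_upwards [hν.valid] with g hg
    apply propext
    have := hg k
    change (g ∈ {g | ∀ j < k, g j = f j}) ↔
      (g ∈ ⋃ i ∈ Finset.range (k + 2), {g | (∀ j < k, g j = f j) ∧ g k = i})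
    simp [this]
  rw [hR, setLIntegral_congr hsets, lintegral_biUnion_finset _ hms]
  · have : ∀ i ∈ Finset.range (k + 2),
        ∫⁻ g in {g | (∀ j < k, g j = f j) ∧ g k = i}, ENNReal.ofReal (φ g) ∂ν =
          ENNReal.ofReal (parentProb p f k i * φ (Function.update f k i)) *
            ν {g | ∀ j < k, g j = f j} := by
      intro i hi
      rw [ENNReal.ofReal_mul (parentProb_nonneg hp0 hp1 f k i), mul_right_comm,
        ← hν.step k f i (Finset.mem_range.1 hi), mul_comm, ← setLIntegral_const]
      refine setLIntegral_congr_fun (hms i hi) fun g hg => ?_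
      have : φ g = φ (Function.update f k i) := hφ _ _ fun j hj => by
        rcases eq_or_ne j k with rfl | h
        · simp [hg.2]
        · rw [Function.update_of_ne h, hg.1 j (by omega)]
      simp only [this]
    rw [Finset.sum_congr rfl this, ← Finset.sum_mul, avg, ENNReal.ofReal_sum_of_nonneg]
    exact fun i _ => mul_nonneg (parentProb_nonneg hp0 hp1 f k i) (h0 _)
  · intro i _ j _ hij
    refine Set.disjoint_left.2 fun g hg hg' => hij ?_
    exact hg.2.symm.trans hg'.2

/-- This says that `avg` is the conditional expectation given the first `k` parents: each past event
is a countable disjoint union of cylinders. -/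
theorem lintegral_step (hν : IsPathLaw ν p) (hp0 : 0 < p) (hp1 : p < 1) {k : ℕ}
    {φ : (ℕ → ℕ) → ℝ} (h0 : ∀ f, 0 ≤ φ f) (hφ : DepOn (k + 1) φ) {A : Set (ℕ → ℕ)}
    (hA : MeasurableSet[pathFiltration k] A) :
    ∫⁻ f in A, ENNReal.ofReal (φ f) ∂ν = ∫⁻ f in A, ENNReal.ofReal (avg p k φ f) ∂ν := by
  obtain ⟨T, _, rfl⟩ := hA
  have hU : res k ⁻¹' T = ⋃ t ∈ T, {g | ∀ j < k, g j = ext k t j} := by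
    ext g
    simp only [Set.mem_preimage, Set.mem_iUnion, Set.mem_ofPred_eq, exists_prop]
    constructor
    · exact fun h => ⟨_, h, fun j hj => (ext_res g hj).symm⟩
    · rintro ⟨t, ht, h⟩
      have : res k g = t := by
        funext j; simp [res, h j j.2, ext]
      rwa [this]
  have hms : ∀ t ∈ T, MeasurableSet {g : ℕ → ℕ | ∀ j < k, g j = ext k t j} := fun t _ =>
    measurableSet_cylinder k _
  have hd : T.PairwiseDisjoint fun t => {g : ℕ → ℕ | ∀ j < k, g j = ext k t j} := by
    intro t _ s _ hts
    refine Set.disjoint_left.2 fun g hg hg' => hts ?_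
    funext j
    have := (hg j j.2).symm.trans (hg' j j.2)
    simpa [ext] using this
  rw [hU, lintegral_biUnion T.to_countable hms hd, lintegral_biUnion T.to_countable hms hd]
  exact tsum_congr fun t => lintegral_cylinder_step hν hp0 hp1 h0 hφ _

/-- A bound on the averages propagates to the integrals over the events of the past. -/
theorem lintegral_le_of_avg_le (hν : IsPathLaw ν p) (hp0 : 0 < p) (hp1 : p < 1) {N : ℕ}
    {φ : ℕ → (ℕ → ℕ) → ℝ} (h0 : ∀ k f, 0 ≤ φ k f) (hφ : ∀ k, DepOn k (φ k)) {A : Set (ℕ → ℕ)}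
    (hA : MeasurableSet[pathFiltration N] A) {c : ℕ → ℝ} (hc : ∀ k, 0 ≤ c k)
    (h : ∀ k, N ≤ k → ∀ f ∈ A, avg p k (φ (k + 1)) f ≤ φ k f + c k) {n : ℕ} (hn : N ≤ n) :
    ∫⁻ f in A, ENNReal.ofReal (φ n f) ∂ν ≤ ∫⁻ f in A, ENNReal.ofReal (φ N f) ∂ν +
      ENNReal.ofReal (∑ k ∈ Finset.Ico N n, c k) * ν A := by
  have hA' : MeasurableSet A := pathFiltration.le N A hA
  induction n, hn using Nat.le_induction with
  | base => simp
  | succ n hn ih =>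
    rw [lintegral_step hν hp0 hp1 (h0 _) (hφ _) (pathFiltration.mono hn A hA),
      Finset.sum_Ico_succ_top hn, ENNReal.ofReal_add (Finset.sum_nonneg fun k _ => hc k) (hc n),
      add_mul, ← add_assoc]
    calc ∫⁻ f in A, ENNReal.ofReal (avg p n (φ (n + 1)) f) ∂ν
        ≤ ∫⁻ f in A, (ENNReal.ofReal (φ n f) + ENNReal.ofReal (c n)) ∂ν :=
          setLIntegral_mono' hA' fun f hf => (ENNReal.ofReal_le_ofReal (h n hn f hf)).trans
            ENNReal.ofReal_add_le
      _ = ∫⁻ f in A, ENNReal.ofReal (φ n f) ∂ν + ENNReal.ofReal (c n) * ν A := by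
          rw [lintegral_add_right _ measurable_const, setLIntegral_const]
      _ ≤ _ := by gcongr

theorem measure_cylinder_pos [IsProbabilityMeasure ν] (hν : IsPathLaw ν p) (hp0 : 0 < p) (N : ℕ) :
    0 < ν {g | ∀ j < N, g j = 0} := by
  induction N with
  | zero => simp
  | succ N ih =>
    have h := hν.step N (fun _ => 0) 0 (by omega)
    have : {g : ℕ → ℕ | ∀ j < N + 1, g j = 0} = {g | (∀ j < N, g j = 0) ∧ g N = 0} := by
      ext g; exact Nat.forall_lt_succ_right
    rw [this, h, parentProb, if_pos rfl]
    exact ENNReal.mul_pos (ENNReal.ofReal_pos.2 hp0).ne' ih.ne'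

theorem measurableSet_zero_cylinder (N : ℕ) :
    MeasurableSet[pathFiltration N] {g : ℕ → ℕ | ∀ j < N, g j = 0} :=
  ⟨{fun _ => 0}, .of_discrete, by ext g; simp [res, funext_iff, Fin.forall_iff]⟩

end

/-! ### Rising factorial moments of the degrees. -/

section

/-- The sum over all vertices but the superstar of the normalized rising factorials of the degrees. -/
noncomputable def risingSum (p : ℝ) (r N n : ℕ) (f : ℕ → ℕ) : ℝ :=
  ∑ i ∈ Finset.Ico 1 (n + 2), ((pdeg f n i).ascFactorial r : ℝ) / grow p r f N n

theorem depOn_risingSum (p : ℝ) (r N n : ℕ) : DepOn n (risingSum p r N n) :=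
  (depOn_pdeg n).comp₂ (depOn_grow' p r N n) fun d x =>
    ∑ i ∈ Finset.Ico 1 (n + 2), ((d i).ascFactorial r : ℝ) / x

variable {p : ℝ} {ν : Measure (ℕ → ℕ)} {r : ℕ}

theorem risingSum_nonneg (hp0 : 0 < p) (hp1 : p < 1) (N n : ℕ) (f : ℕ → ℕ) :
    0 ≤ risingSum p r N n f :=
  Finset.sum_nonneg fun i _ => div_nonneg (Nat.cast_nonneg _)
    (grow_pos hp0 hp1 (by linarith [r.cast_nonneg (α := ℝ)]) f N n).le

/-- As `wt f n ≤ 2 * (n + 1)`, each factor is at least $(n+3)/(n+1)$, and these telescope. Quadratic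
growth makes the contributions $r!/$`grow` of the new vertices summable. -/
theorem le_grow (hr : 4 ≤ r * (1 - p)) (f : ℕ → ℕ) {N n : ℕ} (h : N ≤ n) :
    ((n : ℝ) + 1) * (n + 2) / ((N + 1) * (N + 2)) ≤ grow p r f N n := by
  induction n, h using Nat.le_induction with
  | base => rw [grow_self, div_self (by positivity)]
  | succ n h ih =>
    rw [grow_succ p r f h]
    have hw : (wt f n : ℝ) ≤ 2 * (n + 1) := by
      have : (wt f n : ℝ) ≤ 2 * n + 1 := by exact_mod_cast wt_le f n
      linarith
    have h1 : ((n : ℝ) + 3) / (n + 1) ≤ 1 + r * ((1 - p) / wt f n) := by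
      rw [← mul_div_assoc, div_le_iff₀ (by positivity), add_mul, div_mul_eq_mul_div]
      have h2 : 4 / (2 * ((n : ℝ) + 1)) ≤ r * (1 - p) / wt f n :=
        div_le_div₀ (by linarith) hr (wt_pos f n) hw
      have h3 : 4 / (2 * ((n : ℝ) + 1)) * (n + 1) = 2 := by field_simp; norm_num
      have h4 := mul_le_mul_of_nonneg_right h2 (by positivity : 0 ≤ (n : ℝ) + 1)
      rw [h3, div_mul_eq_mul_div] at h4
      linarith
    refine le_trans (le_of_eq ?_) (mul_le_mul ih h1 (by positivity) (le_trans (by positivity) ih))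
    push_cast
    field_simp
    ring

theorem avg_risingSum_le (hp0 : 0 < p) (hp1 : p < 1) (hr : 4 ≤ r * (1 - p)) (f : ℕ → ℕ)
    {N k : ℕ} (h : N ≤ k) : avg p k (risingSum p r N (k + 1)) f ≤ risingSum p r N k f +
      r.factorial * ((N + 1) * (N + 2)) / (((k : ℝ) + 2) * (k + 3)) := by
  have hr' : (-1 : ℝ) < r := by linarith [r.cast_nonneg (α := ℝ)]
  have hs : risingSum p r N (k + 1) = fun f =>
      (∑ i ∈ Finset.Ico 1 (k + 2), ((pdeg f (k + 1) i).ascFactorial r : ℝ) / grow p r f N (k + 1)) +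
        (r.factorial : ℝ) / grow p r f N (k + 1) := by
    funext f
    rw [risingSum, show k + 1 + 2 = (k + 2) + 1 by ring, Finset.sum_Ico_succ_top (by omega)]
    congr 3
    simp [pdeg, pdeg_eq_zero f (le_refl (k + 2)), Nat.one_ascFactorial]
  rw [hs, avg_add, avg_sum, avg_of_depOn p f ((depOn_grow p r N k).comp fun x => _ / x)]
  refine add_le_add (Finset.sum_le_sum fun i hi => ?_) ?_
  · obtain ⟨h1, h2⟩ := Finset.mem_Ico.1 hi
    refine (avg_pdeg_div_grow hp0 hp1 hr' f h h1 h2 (g := fun D => (D.ascFactorial r : ℝ))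
      fun D _ => ?_).le
    have := Nat.succ_ascFactorial D r
    have : (D : ℝ) * ((D + 1).ascFactorial r) = (D + r) * D.ascFactorial r := by exact_mod_cast this
    linear_combination this
  · have h1 := le_grow hr f (h.trans k.le_succ)
    push_cast at h1
    refine (div_le_div_of_nonneg_left (by positivity) (by positivity) h1).trans (le_of_eq ?_)
    field_simp
    ring

theorem sum_inv_mul_le (N n : ℕ) (h : N ≤ n) :
    ∑ k ∈ Finset.Ico N n, 1 / (((k : ℝ) + 2) * (k + 3)) = 1 / (N + 2) - 1 / (n + 2) := by
  induction n, h using Nat.le_induction with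
  | base => simp
  | succ n h ih =>
    rw [Finset.sum_Ico_succ_top h, ih]
    push_cast
    field_simp
    ring

/-- All vertices born after time `N` together add at most $r!(N+1)(N+2)\sum_{k\ge
N}\frac1{(k+2)(k+3)}=r!(N+1)$ to the mean. -/
theorem lintegral_risingSum_le (hν : IsPathLaw ν p) (hp0 : 0 < p) (hp1 : p < 1)
    (hr : 4 ≤ r * (1 - p)) {A : Set (ℕ → ℕ)} {N n : ℕ} (hA : MeasurableSet[pathFiltration N] A)
    (h : N ≤ n) : ∫⁻ f in A, ENNReal.ofReal (risingSum p r N n f) ∂ν ≤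
      ∫⁻ f in A, ENNReal.ofReal (risingSum p r N N f) ∂ν +
        ENNReal.ofReal (r.factorial * (N + 1)) * ν A := by
  refine (lintegral_le_of_avg_le hν hp0 hp1 (φ := fun n => risingSum p r N n)
    (fun k f => risingSum_nonneg hp0 hp1 N k f) (depOn_risingSum p r N) hA
    (c := fun k => r.factorial * ((N + 1) * (N + 2)) / (((k : ℝ) + 2) * (k + 3)))
    (fun k => by positivity) (fun k hk f _ => avg_risingSum_le hp0 hp1 hr f hk) h).trans ?_
  gcongr
  have : ∀ k ∈ Finset.Ico N n, r.factorial * (((N : ℝ) + 1) * (N + 2)) / (((k : ℝ) + 2) * (k + 3)) =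
      r.factorial * ((N + 1) * (N + 2)) * (1 / (((k : ℝ) + 2) * (k + 3))) := fun k _ => by ring
  rw [Finset.sum_congr rfl this, ← Finset.mul_sum, sum_inv_mul_le N n h]
  have h1 : 0 ≤ r.factorial * (((N : ℝ) + 1) * (N + 2)) * (1 / (n + 2)) := by positivity
  have h2 : r.factorial * (((N : ℝ) + 1) * (N + 2)) * (1 / (N + 2)) = r.factorial * (N + 1) := by
    field_simp
  rw [mul_sub, h2]
  linarith

theorem grow_le_pow (hp1 : p < 1) (f : ℕ → ℕ) (N n : ℕ) :
    grow p r f N n ≤ grow p 1 f N n ^ r := by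
  rw [grow, grow, ← Finset.prod_pow]
  refine Finset.prod_le_prod (fun k _ => ?_) fun k _ => ?_
  · have := (rate_pos hp1 f k).le
    positivity
  · rw [one_mul]
    exact one_add_mul_le_pow (by linarith [rate_pos hp1 f k]) r

/-- The maximal term is one summand, $D^r$ is at most the rising factorial, and Bernoulli's
inequality compares the two normalizations. -/
theorem pmax_div_grow_pow_le (hp0 : 0 < p) (hp1 : p < 1) (f : ℕ → ℕ) (N n : ℕ) :
    ((pmax f n : ℝ) / grow p 1 f N n) ^ r ≤ risingSum p r N n f := by
  have hr' : (-1 : ℝ) < r := by linarith [r.cast_nonneg (α := ℝ)]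
  have hg := grow_pos hp0 hp1 hr' f N n
  obtain ⟨i, hi, h⟩ := exists_pdeg_eq_pmax f n
  have h1 : (pmax f n : ℝ) ^ r ≤ (pdeg f n i).ascFactorial r := by
    rw [← h]
    exact_mod_cast Nat.pow_succ_le_ascFactorial _ r
  rw [div_pow]
  calc (pmax f n : ℝ) ^ r / grow p 1 f N n ^ r
      ≤ (pdeg f n i).ascFactorial r / grow p r f N n :=
        div_le_div₀ (Nat.cast_nonneg _) h1 hg (grow_le_pow hp1 f N n)
    _ ≤ risingSum p r N n f :=
        Finset.single_le_sum (f := fun i => ((pdeg f n i).ascFactorial r : ℝ) / grow p r f N n)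
          (fun i _ => div_nonneg (Nat.cast_nonneg _) hg.le) hi

end

/-! ### Convergence of the normalized maximum and positivity of its limit. -/

section

variable {p : ℝ} {ν : Measure (ℕ → ℕ)}

theorem one_le_grow (hp1 : p < 1) (f : ℕ → ℕ) (N n : ℕ) : 1 ≤ grow p 1 f N n :=
  Finset.prod_induction _ (1 ≤ ·) (fun _ _ => one_le_mul_of_one_le_of_one_le) le_rfl
    fun k _ => by linarith [rate_pos hp1 f k]

/-- The maximal degree, normalized. -/
noncomputable def normMax (p : ℝ) (n : ℕ) (f : ℕ → ℕ) : ℝ := (pmax f n : ℝ) / grow p 1 f 0 n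

theorem depOn_normMax (p : ℝ) (n : ℕ) : DepOn n (normMax p n) :=
  (depOn_pmax n).comp₂ (depOn_grow' p 1 0 n) fun d x => (d : ℝ) / x

theorem normMax_nonneg (hp1 : p < 1) (n : ℕ) (f : ℕ → ℕ) : 0 ≤ normMax p n f :=
  div_nonneg (Nat.cast_nonneg _) (zero_le_one.trans (one_le_grow hp1 f 0 n))

theorem normMax_le (hp1 : p < 1) (n : ℕ) (f : ℕ → ℕ) : normMax p n f ≤ 2 * n + 1 := by
  have h : (pmax f n : ℝ) ≤ 2 * n + 1 := by exact_mod_cast (pmax_le_wt f n).trans (wt_le f n)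
  exact (div_le_self (Nat.cast_nonneg _) (one_le_grow hp1 f 0 n)).trans h

theorem integrable_normMax [IsProbabilityMeasure ν] (hp1 : p < 1) (n : ℕ) :
    Integrable (normMax p n) ν :=
  Integrable.of_bound (depOn_normMax p n).measurable.aestronglyMeasurable (2 * n + 1)
    (ae_of_all _ fun f => by
      rw [Real.norm_of_nonneg (normMax_nonneg hp1 n f)]; exact normMax_le hp1 n f)

/-- A vertex that is maximal at time `k` has a normalized degree that is a martingale, and the next
maximum dominates it. -/
theorem normMax_le_avg (hp0 : 0 < p) (hp1 : p < 1) (k : ℕ) (f : ℕ → ℕ) :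
    normMax p k f ≤ avg p k (normMax p (k + 1)) f := by
  obtain ⟨i, hi, h⟩ := exists_pdeg_eq_pmax f k
  obtain ⟨h1, h2⟩ := Finset.mem_Ico.1 hi
  have h3 := avg_pdeg_div_grow hp0 hp1 (by norm_num : (-1 : ℝ) < 1) f (Nat.zero_le k) h1 h2
    (g := fun D => (D : ℝ)) (fun D _ => by push_cast; ring)
  rw [normMax, ← h, ← h3]
  refine avg_mono hp0 hp1 f k fun g => ?_
  exact div_le_div_of_nonneg_right (by exact_mod_cast pdeg_le_pmax g h1)
    (zero_le_one.trans (one_le_grow hp1 g 0 (k + 1)))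

theorem submartingale_normMax [IsProbabilityMeasure ν] (hν : IsPathLaw ν p) (hp0 : 0 < p)
    (hp1 : p < 1) : Submartingale (normMax p) pathFiltration ν := by
  refine submartingale_of_setIntegral_le_succ
    (fun n => (depOn_normMax p n).measurable_filtration.stronglyMeasurable)
    (fun n => integrable_normMax hp1 n) fun k A hA => ?_
  have hI : ∀ n, ∫ f in A, normMax p n f ∂ν =
      (∫⁻ f in A, ENNReal.ofReal (normMax p n f) ∂ν).toReal := fun n =>
    integral_eq_lintegral_of_nonneg_ae (ae_of_all _ (normMax_nonneg hp1 n))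
      (depOn_normMax p n).measurable.aestronglyMeasurable
  rw [hI, hI]
  refine ENNReal.toReal_mono ?_ ?_
  · exact ((hasFiniteIntegral_iff_ofReal (ae_of_all _ (normMax_nonneg hp1 _))).1
      (integrable_normMax (ν := ν) hp1 (k + 1)).integrableOn.2).ne
  · rw [lintegral_step hν hp0 hp1 (normMax_nonneg hp1 _) (depOn_normMax p _) hA]
    exact lintegral_mono fun f => ENNReal.ofReal_le_ofReal (normMax_le_avg hp0 hp1 k f)

theorem exists_tendsto_normMax [IsProbabilityMeasure ν] (hν : IsPathLaw ν p) (hp0 : 0 < p)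
    (hp1 : p < 1) : ∀ᵐ f ∂ν, ∃ c, Tendsto (fun n => normMax p n f) atTop (𝓝 c) := by
  obtain ⟨r, hr⟩ := exists_nat_ge (4 / (1 - p))
  rw [div_le_iff₀ (by linarith)] at hr
  have hr1 : 1 ≤ r := Nat.one_le_iff_ne_zero.2 fun h => by rw [h] at hr; norm_num at hr
  -- The bound uses $x\le 1+x^r$; one $r!$ is the initial value of `risingSum`, the other the
  -- contribution of the new vertices.
  refine (submartingale_normMax hν hp0 hp1).exists_ae_tendsto_of_bdd
    (R := 1 + ((r.factorial : NNReal) + r.factorial)) fun n => ?_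
  rw [eLpNorm_one_eq_lintegral_enorm]
  have h0 : ∀ f, risingSum p r 0 0 f = r.factorial := fun f => by
    rw [risingSum, Finset.sum_Ico_succ_top (by omega)]
    simp [grow_self, pdeg, Nat.one_ascFactorial]
  calc ∫⁻ f, ‖normMax p n f‖ₑ ∂ν
      ≤ ∫⁻ f, (1 + ENNReal.ofReal (risingSum p r 0 n f)) ∂ν := by
        refine lintegral_mono fun f => ?_
        rw [Real.enorm_of_nonneg (normMax_nonneg hp1 n f), ← ENNReal.ofReal_one,
          ← ENNReal.ofReal_add zero_le_one (risingSum_nonneg hp0 hp1 0 n f)]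
        refine ENNReal.ofReal_le_ofReal ?_
        have h1 := pmax_div_grow_pow_le (r := r) hp0 hp1 f 0 n
        have h2 : normMax p n f ≤ 1 + normMax p n f ^ r := by
          rcases le_total (normMax p n f) 1 with h | h
          · linarith [pow_nonneg (normMax_nonneg hp1 n f) r]
          · linarith [le_self_pow₀ h (by omega : r ≠ 0)]
        exact h2.trans (by unfold normMax; linarith)
    _ = 1 + ∫⁻ f in Set.univ, ENNReal.ofReal (risingSum p r 0 n f) ∂ν := by
        rw [lintegral_add_left measurable_const]; simp
    _ ≤ 1 + (∫⁻ f in Set.univ, ENNReal.ofReal (risingSum p r 0 0 f) ∂ν +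
        ENNReal.ofReal (r.factorial * ((0 : ℕ) + 1)) * ν Set.univ) := by
        gcongr
        exact lintegral_risingSum_le hν hp0 hp1 hr MeasurableSet.univ (Nat.zero_le n)
    _ = _ := by simp [h0]

/-- The product `(1 - 1/2) (1 - 1/4) ⋯ (1 - 1/(2(D-1)))`. -/
noncomputable def halfProd (D : ℕ) : ℝ := ∏ j ∈ Finset.Ico 1 D, (1 - 1 / (2 * (j : ℝ)))

theorem halfProd_succ {D : ℕ} (h : 1 ≤ D) : halfProd (D + 1) = halfProd D * (1 - 1 / (2 * D)) :=
  Finset.prod_Ico_succ_top h _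

theorem halfProd_pos (D : ℕ) : 0 < halfProd D := by
  refine Finset.prod_pos fun j hj => ?_
  have : (1 : ℝ) ≤ j := by exact_mod_cast (Finset.mem_Ico.1 hj).1
  rw [sub_pos, div_lt_one (by linarith)]
  linarith

theorem le_halfProd_sq {D : ℕ} (h : 1 ≤ D) : 1 / (4 * (D : ℝ)) ≤ halfProd D ^ 2 := by
  -- The index shift is needed: the induction closes because $(1-\frac1{2(E+1)})^2\ge\frac E{E+1}$,
  -- while the unshifted bound is not inductive.
  have key : ∀ E : ℕ, 1 ≤ E → 1 / (4 * (E : ℝ)) ≤ halfProd (E + 1) ^ 2 := by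
    intro E hE
    induction E, hE using Nat.le_induction with
    | base => simp [halfProd]; norm_num
    | succ E hE ih =>
      have hE' : (1 : ℝ) ≤ E := by exact_mod_cast hE
      rw [halfProd_succ (by omega), mul_pow]
      refine le_trans ?_ (mul_le_mul_of_nonneg_right ih (by positivity))
      push_cast
      have : 1 / (4 * (E : ℝ)) * (1 - 1 / (2 * (E + 1))) ^ 2 =
          (4 * E * (E + 1) + 1) / (16 * E * (E + 1) ^ 2) := by
        field_simp; ring
      rw [this, div_le_div_iff₀ (by positivity) (by positivity)]
      nlinarith
  rcases h.eq_or_lt with rfl | h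
  · simp [halfProd]; norm_num
  · obtain ⟨E, rfl⟩ := Nat.exists_eq_add_of_le' h.le
    refine le_trans ?_ (key E (by omega))
    have : (1 : ℝ) ≤ E := by exact_mod_cast (by omega : 1 ≤ E)
    exact one_div_le_one_div_of_le (by positivity) (by push_cast; linarith)

/-- A martingale that behaves like the inverse square root of the normalized degree of `v_1`. -/
noncomputable def invRoot (p : ℝ) (n : ℕ) (f : ℕ → ℕ) : ℝ :=
  halfProd (pdeg f n 1) / grow p (-1 / 2) f 0 n

theorem depOn_invRoot (p : ℝ) (n : ℕ) : DepOn n (invRoot p n) :=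
  (depOn_pdeg n).comp₂ (depOn_grow' p (-1 / 2) 0 n) fun d x => halfProd (d 1) / x

theorem invRoot_nonneg (hp0 : 0 < p) (hp1 : p < 1) (n : ℕ) (f : ℕ → ℕ) : 0 ≤ invRoot p n f :=
  div_nonneg (halfProd_pos _).le (grow_pos hp0 hp1 (by norm_num) f 0 n).le

/-- `halfProd` solves $D(g(D+1)-g(D))=-\frac12g(D)$, and the martingale starts at 1 since $v_1$ has
degree 1 at time 0. -/
theorem lintegral_invRoot_le [IsProbabilityMeasure ν] (hν : IsPathLaw ν p) (hp0 : 0 < p)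
    (hp1 : p < 1) (n : ℕ) : ∫⁻ f, ENNReal.ofReal (invRoot p n f) ∂ν ≤ 1 := by
  have h := lintegral_le_of_avg_le hν hp0 hp1 (φ := invRoot p)
    (invRoot_nonneg hp0 hp1) (depOn_invRoot p) (A := Set.univ) (N := 0)
    MeasurableSet.univ (c := fun _ => 0) (fun _ => le_rfl) (fun k _ f _ => ?_) (Nat.zero_le n)
  · simpa [invRoot, pdeg, grow_self, halfProd] using h
  · rw [add_zero]
    refine (avg_pdeg_div_grow hp0 hp1 (by norm_num : (-1 : ℝ) < -1 / 2) f (Nat.zero_le k) le_rfl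
      (by omega) (g := halfProd) fun D hD => ?_).le
    have : (1 : ℝ) ≤ D := by exact_mod_cast hD
    rw [halfProd_succ hD]
    field_simp
    ring

/-- Factor by factor, $(1-x/2)^2(1+x)=1-x^2(3-x)/4\le1$ for $0\le x\le1$. -/
theorem grow_neg_half_sq_mul_le (hp0 : 0 < p) (hp1 : p < 1) (f : ℕ → ℕ) (N n : ℕ) :
    grow p (-1 / 2) f N n ^ 2 * grow p 1 f N n ≤ 1 := by
  rw [grow, grow, ← Finset.prod_pow, ← Finset.prod_mul_distrib]
  have hx := fun k => (rate_pos hp1 f k).le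
  have hx1 : ∀ k, (1 - p) / wt f k ≤ 1 := fun k => (rate_le hp0 f k).trans
    (div_le_one_of_le₀ (by linarith [k.cast_nonneg (α := ℝ)]) (by positivity))
  refine Finset.prod_le_one (fun k _ => ?_) fun k _ => ?_
  · have := hx k
    positivity
  · have h0 := hx k
    have h1 := hx1 k
    generalize (1 - p) / (wt f k : ℝ) = x at h0 h1
    nlinarith [mul_nonneg (mul_nonneg h0 h0) (by linarith : 0 ≤ 3 - x)]

theorem le_invRoot_sq_mul (hp0 : 0 < p) (hp1 : p < 1) (n : ℕ) (f : ℕ → ℕ) :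
    1 / 4 ≤ invRoot p n f ^ 2 * normMax p n f := by
  have hD : 1 ≤ pdeg f n 1 := pdeg_pos f (by omega)
  have hD' : (1 : ℝ) ≤ pdeg f n 1 := by exact_mod_cast hD
  have hb := grow_pos hp0 hp1 (by norm_num : (-1 : ℝ) < -1 / 2) f 0 n
  have ha := grow_pos hp0 hp1 (by norm_num : (-1 : ℝ) < 1) f 0 n
  have h1 : (pdeg f n 1 : ℝ) / grow p 1 f 0 n ≤ normMax p n f :=
    div_le_div_of_nonneg_right (by exact_mod_cast pdeg_le_pmax f le_rfl) ha.le
  have h2 := le_halfProd_sq hD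
  have h3 := grow_neg_half_sq_mul_le hp0 hp1 f 0 n
  calc (1 : ℝ) / 4 ≤ 1 / 4 / (grow p (-1 / 2) f 0 n ^ 2 * grow p 1 f 0 n) :=
        le_div_self (by norm_num) (by positivity) h3
    _ = 1 / (4 * (pdeg f n 1 : ℝ)) / grow p (-1 / 2) f 0 n ^ 2 *
        ((pdeg f n 1 : ℝ) / grow p 1 f 0 n) := by field_simp
    _ ≤ invRoot p n f ^ 2 * normMax p n f := by
        rw [invRoot, div_pow]
        gcongr

/-- By Fatou the lower limit of `invRoot` is almost surely finite, whereas `le_invRoot_sq_mul`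
forces `invRoot` to infinity when `normMax` tends to 0. -/
theorem not_tendsto_normMax_zero [IsProbabilityMeasure ν] (hν : IsPathLaw ν p) (hp0 : 0 < p)
    (hp1 : p < 1) : ∀ᵐ f ∂ν, ¬ Tendsto (fun n => normMax p n f) atTop (𝓝 0) := by
  have hm : ∀ n, Measurable fun f => ENNReal.ofReal (invRoot p n f) := fun n =>
    (depOn_invRoot p n).measurable.ennreal_ofReal
  have h1 : ∫⁻ f, liminf (fun n => ENNReal.ofReal (invRoot p n f)) atTop ∂ν ≤ 1 := by
    refine (lintegral_liminf_le hm).trans ?_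
    refine (liminf_le_liminf (Eventually.of_forall (lintegral_invRoot_le hν hp0 hp1))).trans ?_
    simp
  filter_upwards [ae_lt_top (Measurable.liminf hm) (h1.trans_lt ENNReal.one_lt_top).ne]
    with f hf h0
  obtain ⟨C, hC, hC'⟩ := exists_between hf
  have hfreq := frequently_lt_of_liminf_lt (by isBoundedDefault) hC
  have hev : ∀ᶠ n in atTop, normMax p n f < 1 / (4 * (C.toReal + 1) ^ 2) :=
    h0.eventually_lt_const (by positivity)
  obtain ⟨n, hn1, hn2⟩ := (hfreq.and_eventually hev).exists
  have hR := (ENNReal.ofReal_lt_iff_lt_toReal (invRoot_nonneg hp0 hp1 n f) hC'.ne).1 hn1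
  have h4 := le_invRoot_sq_mul hp0 hp1 n f
  have h5 : invRoot p n f ^ 2 ≤ (C.toReal + 1) ^ 2 :=
    pow_le_pow_left₀ (invRoot_nonneg hp0 hp1 n f) (by linarith) 2
  have h6 : invRoot p n f ^ 2 * normMax p n f ≤ (C.toReal + 1) ^ 2 * normMax p n f :=
    mul_le_mul_of_nonneg_right h5 (normMax_nonneg hp1 n f)
  have h7 : (C.toReal + 1) ^ 2 * normMax p n f < 1 / 4 := by
    have : (0 : ℝ) < (C.toReal + 1) ^ 2 := by positivity
    rw [lt_div_iff₀ (by positivity)] at hn2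
    linarith
  linarith

end

/-! ### Concentration of the total weight and the growth of the normalization. -/

section

variable {p : ℝ} {ν : Measure (ℕ → ℕ)}

/-- The sequences along which the first `N` new vertices attach to the superstar. -/
def zeroCyl (N : ℕ) : Set (ℕ → ℕ) := {g | ∀ j < N, g j = 0}

theorem wt_of_mem_zeroCyl {N : ℕ} {f : ℕ → ℕ} (hf : f ∈ zeroCyl N) : wt f N = N + 1 := by
  induction N with
  | zero => rw [wt_zero]
  | succ N ih =>
    rw [wt_succ, ih fun j hj => hf j (by omega), hf N (by omega)]
    simp

/-- The deviation of the total degree from its mean, when it is `N + 1` at time `N`. -/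
noncomputable def dev (p : ℝ) (N k : ℕ) (f : ℕ → ℕ) : ℝ :=
  (wt f k : ℝ) - (N + 1) - (2 - p) * ((k : ℝ) - N)

theorem depOn_dev (p : ℝ) (N k : ℕ) : DepOn k (dev p N k) :=
  (depOn_wt k).comp fun w => (w : ℝ) - (N + 1) - (2 - p) * ((k : ℝ) - N)

/-- On `zeroCyl N` the deviation starts at 0 at time `N`, and its increments are centred with
variance $p(1-p)\le1$. -/
theorem lintegral_dev_sq_le (hν : IsPathLaw ν p) (hp0 : 0 < p) (hp1 : p < 1) {N n : ℕ}
    (h : N ≤ n) : ∫⁻ f in zeroCyl N, ENNReal.ofReal (dev p N n f ^ 2) ∂ν ≤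
      ENNReal.ofReal ((n : ℝ) - N) * ν (zeroCyl N) := by
  have h1 := lintegral_le_of_avg_le hν hp0 hp1 (φ := fun k f => dev p N k f ^ 2)
    (fun k f => sq_nonneg _) (fun k => (depOn_dev p N k).comp fun x => x ^ 2)
    (measurableSet_zero_cylinder N) (c := fun _ => 1) (fun _ => zero_le_one)
    (fun k _ f _ => ?_) h
  · have h2 : ∫⁻ f in zeroCyl N, ENNReal.ofReal (dev p N N f ^ 2) ∂ν = 0 := by
      have hms : MeasurableSet (zeroCyl N) :=
        pathFiltration.le N _ (measurableSet_zero_cylinder N)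
      rw [setLIntegral_congr_fun (g := fun _ => 0) hms]
      · simp
      · intro f hf
        simp [dev, wt_of_mem_zeroCyl hf]
    refine h1.trans (le_of_eq ?_)
    change ∫⁻ f in zeroCyl N, ENNReal.ofReal (dev p N N f ^ 2) ∂ν + _ = _
    rw [h2, zero_add]
    simp [zeroCyl, Nat.cast_sub h]
  · have h3 := avg_wt p f k fun w => ((w : ℝ) - (N + 1) - (2 - p) * (((k + 1 : ℕ) : ℝ) - N)) ^ 2
    change avg p k (fun f => ((wt f (k + 1) : ℝ) - (N + 1) -
      (2 - p) * (((k + 1 : ℕ) : ℝ) - N)) ^ 2) f ≤ _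
    rw [h3, dev]
    push_cast
    nlinarith [mul_pos hp0 (sub_pos.2 hp1)]

/-- A weighted sum of the squares of the deviations. -/
noncomputable def devSum (p : ℝ) (N : ℕ) (f : ℕ → ℕ) : ENNReal :=
  ∑' k : ℕ, ENNReal.ofReal (dev p N (N + k) f ^ 2 * ((N + k : ℕ) + 1 : ℝ) ^ (-(5 / 2) : ℝ))

/-- The sum of the series of the `(k + 1) ^ (-3/2)`. -/
noncomputable def zetaSum : ℝ := ∑' k : ℕ, ((k : ℝ) + 1) ^ (-(3 / 2) : ℝ)

theorem summable_zetaSum : Summable fun k : ℕ => ((k : ℝ) + 1) ^ (-(3 / 2) : ℝ) := by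
  have h := (summable_nat_add_iff 1).2 (Real.summable_nat_rpow.2 (by norm_num : (-(3 / 2) : ℝ) < -1))
  simpa using h

theorem zetaSum_pos : 0 < zetaSum :=
  summable_zetaSum.tsum_pos (fun k => by positivity) 0 (by simp)

theorem measurable_devSum (p : ℝ) (N : ℕ) : Measurable (devSum p N) :=
  Measurable.tsum fun k =>
    (((depOn_dev p N (N + k)).measurable.pow_const 2).mul_const _).ennreal_ofReal

/-- A second moment of order $k$ against the weight $k^{-5/2}$ leaves the summable $k^{-3/2}$. The
constant does not depend on `N`, which the non-degeneracy argument needs. -/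
theorem lintegral_devSum_le (hν : IsPathLaw ν p) (hp0 : 0 < p) (hp1 : p < 1) (N : ℕ) :
    ∫⁻ f in zeroCyl N, devSum p N f ∂ν ≤ ENNReal.ofReal zetaSum * ν (zeroCyl N) := by
  unfold devSum zetaSum
  rw [lintegral_tsum fun k =>
    (((depOn_dev p N (N + k)).measurable.pow_const 2).mul_const _).ennreal_ofReal.aemeasurable,
    ENNReal.ofReal_tsum_of_nonneg (fun k => by positivity) summable_zetaSum, ← ENNReal.tsum_mul_right]
  refine ENNReal.tsum_le_tsum fun k => ?_
  simp only [ENNReal.ofReal_mul (sq_nonneg _)]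
  rw [lintegral_mul_const _ ((depOn_dev p N (N + k)).measurable.pow_const 2).ennreal_ofReal]
  refine (mul_le_mul_left (lintegral_dev_sq_le hν hp0 hp1 (N.le_add_right k)) _).trans ?_
  rw [mul_right_comm, ← ENNReal.ofReal_mul (by push_cast; simp)]
  gcongr
  have h1 : (0 : ℝ) < ((N + k : ℕ) : ℝ) + 1 := by positivity
  calc (((N + k : ℕ) : ℝ) - N) * (((N + k : ℕ) : ℝ) + 1) ^ (-(5 / 2) : ℝ)
      ≤ (((N + k : ℕ) : ℝ) + 1) * (((N + k : ℕ) : ℝ) + 1) ^ (-(5 / 2) : ℝ) := by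
        gcongr; linarith [N.cast_nonneg (α := ℝ)]
    _ = (((N + k : ℕ) : ℝ) + 1) ^ (-(3 / 2) : ℝ) := by
        nth_rewrite 1 [← Real.rpow_one (((N + k : ℕ) : ℝ) + 1)]
        rw [← Real.rpow_add h1]; norm_num
    _ ≤ ((k : ℝ) + 1) ^ (-(3 / 2) : ℝ) := by
        refine Real.rpow_le_rpow_of_nonpos (by positivity) ?_ (by norm_num)
        push_cast; linarith [N.cast_nonneg (α := ℝ)]

theorem sum_dev_sq_le {N : ℕ} {f : ℕ → ℕ} (hf : devSum p N f ≠ ⊤) (n : ℕ) :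
    ∑ k ∈ Finset.Ico N n, dev p N k f ^ 2 * ((k : ℝ) + 1) ^ (-(5 / 2) : ℝ) ≤
      (devSum p N f).toReal := by
  rw [← ENNReal.ofReal_le_iff_le_toReal hf, Finset.sum_Ico_eq_sum_range,
    ENNReal.ofReal_sum_of_nonneg fun k _ => by positivity]
  exact ENNReal.sum_le_tsum _

theorem sum_Ico_zeta_le (N n : ℕ) :
    ∑ k ∈ Finset.Ico N n, ((k : ℝ) + 1) ^ (-(3 / 2) : ℝ) ≤ zetaSum :=
  summable_zetaSum.sum_le_tsum _ fun k _ => by positivity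

/-- The first term is at most 1, and the others telescope via
$\frac1{(n+1)^2}\le\frac1n-\frac1{n+1}$ to at most 1. -/
theorem sum_Ico_inv_sq_le (N n : ℕ) :
    ∑ k ∈ Finset.Ico N n, ((N : ℝ) + 1) / ((k : ℝ) + 1) ^ 2 ≤ 2 := by
  have key : ∀ n, N + 1 ≤ n → ∑ k ∈ Finset.Ico N n, ((N : ℝ) + 1) / ((k : ℝ) + 1) ^ 2 ≤
      2 - ((N : ℝ) + 1) / n := by
    intro n hn
    induction n, hn using Nat.le_induction with
    | base =>
      simp only [Finset.sum_Ico_succ_top le_rfl, Finset.Ico_self, Finset.sum_empty, zero_add]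
      push_cast
      rw [div_self (by positivity : (N : ℝ) + 1 ≠ 0), div_le_iff₀ (by positivity)]
      nlinarith [N.cast_nonneg (α := ℝ)]
    | succ n hn ih =>
      rw [Finset.sum_Ico_succ_top (by omega)]
      have hn' : (1 : ℝ) ≤ n := by exact_mod_cast (by omega : 1 ≤ n)
      have : ((N : ℝ) + 1) / (n + 1) ^ 2 ≤ (N + 1) / n - (N + 1) / (n + 1) := by
        rw [div_sub_div _ _ (by positivity) (by positivity),
          div_le_div_iff₀ (by positivity) (by positivity)]
        nlinarith [N.cast_nonneg (α := ℝ),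
          mul_nonneg (by positivity : 0 ≤ (N : ℝ) + 1) (by positivity : 0 ≤ (n : ℝ) + 1)]
      push_cast
      linarith
  rcases Nat.lt_or_ge N n with h | h
  · have := key n h
    have : 0 ≤ ((N : ℝ) + 1) / n := by positivity
    linarith
  · simp [Finset.Ico_eq_empty_of_le h]

/-- The exponent of the growth of the degrees. -/
noncomputable def expo (p : ℝ) : ℝ := (1 - p) / (2 - p)

theorem expo_pos (hp1 : p < 1) : 0 < expo p := div_pos (by linarith) (by linarith)

theorem abs_rate_sub_le (hp0 : 0 < p) (hp1 : p < 1) (N k : ℕ) (f : ℕ → ℕ) :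
    |(1 - p) / wt f k - expo p / (k + 1)| ≤ ((N : ℝ) + 1) / ((k : ℝ) + 1) ^ 2 +
      (dev p N k f ^ 2 * ((k : ℝ) + 1) ^ (-(5 / 2) : ℝ) + ((k : ℝ) + 1) ^ (-(3 / 2) : ℝ)) / 2 := by
  have hk : (0 : ℝ) < (k : ℝ) + 1 := by positivity
  have hw := wt_pos f k
  have hw1 : ((k : ℝ) + 1) ≤ wt f k := by exact_mod_cast le_wt f k
  have h2 : 0 < 2 - p := by linarith
  -- This is $(2-p)(k+1)-w_k=(1-p)(N+1)-\mathrm{dev}$.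
  have e1 : (1 - p) / wt f k - expo p / (k + 1) =
      (1 - p) / (2 - p) * (((1 - p) * (N + 1) - dev p N k f) / (wt f k * (k + 1))) := by
    unfold expo dev
    field_simp
    ring
  have e2 : |(1 - p) / wt f k - expo p / (k + 1)| ≤
      ((N : ℝ) + 1 + |dev p N k f|) / ((k : ℝ) + 1) ^ 2 := by
    rw [e1, abs_mul, abs_of_pos (show 0 < (1 - p) / (2 - p) from expo_pos hp1), abs_div,
      abs_of_pos (by positivity : 0 < (wt f k : ℝ) * (k + 1))]
    have h3 : (1 - p) / (2 - p) ≤ 1 := by rw [div_le_one h2]; linarith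
    refine (mul_le_of_le_one_left (by positivity) h3).trans ?_
    refine div_le_div₀ (by positivity) ?_ (by positivity) (by nlinarith)
    refine (abs_sub _ _).trans (add_le_add_left ?_ _)
    rw [abs_of_pos (mul_pos (by linarith) (by positivity))]
    nlinarith [N.cast_nonneg (α := ℝ)]
  refine e2.trans ?_
  rw [add_div]
  refine add_le_add le_rfl ?_
  -- The inequality $|d|\le(d^2s^2+s^{-2})/2$ trades the deviation for its square; this `s` turns
  -- $(k+1)^{-2}$ into the exponents $-5/2$ and $-3/2$.
  set s := ((k : ℝ) + 1) ^ (-(1 / 4) : ℝ) with hs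
  have hs0 : 0 < s := by positivity
  have e3 : ((k : ℝ) + 1) ^ (-(5 / 2) : ℝ) = (1 / ((k : ℝ) + 1) ^ 2) * (s * s) := by
    rw [hs, ← Real.rpow_add hk, one_div, ← Real.rpow_natCast, ← Real.rpow_neg hk.le,
      ← Real.rpow_add hk]
    norm_num
  have e4 : ((k : ℝ) + 1) ^ (-(3 / 2) : ℝ) = (1 / ((k : ℝ) + 1) ^ 2) * (s⁻¹ * s⁻¹) := by
    rw [hs, ← Real.rpow_neg hk.le, ← Real.rpow_add hk, one_div, ← Real.rpow_natCast,
      ← Real.rpow_neg hk.le, ← Real.rpow_add hk]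
    norm_num
  rw [e3, e4, ← sq_abs (dev p N k f)]
  have h5 : |dev p N k f| ≤ (|dev p N k f| ^ 2 * (s * s) + s⁻¹ * s⁻¹) / 2 := by
    have h6 := sq_nonneg (|dev p N k f| * s - s⁻¹)
    have h7 : s * s⁻¹ = 1 := mul_inv_cancel₀ hs0.ne'
    generalize s⁻¹ = t at h6 h7 ⊢
    have h8 : (|dev p N k f| * s - t) ^ 2 =
        |dev p N k f| ^ 2 * (s * s) + t * t - 2 * |dev p N k f| * (s * t) := by ring
    rw [h7] at h8
    linarith
  calc |dev p N k f| / ((k : ℝ) + 1) ^ 2 = 1 / ((k : ℝ) + 1) ^ 2 * |dev p N k f| := by ring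
    _ ≤ 1 / ((k : ℝ) + 1) ^ 2 * ((|dev p N k f| ^ 2 * (s * s) + s⁻¹ * s⁻¹) / 2) := by gcongr
    _ = _ := by ring

theorem sum_abs_rate_sub_le (hp0 : 0 < p) (hp1 : p < 1) {N : ℕ} {f : ℕ → ℕ}
    (hf : devSum p N f ≠ ⊤) (n : ℕ) :
    ∑ k ∈ Finset.Ico N n, |(1 - p) / wt f k - expo p / (k + 1)| ≤
      2 + ((devSum p N f).toReal + zetaSum) / 2 := by
  refine (Finset.sum_le_sum fun k _ => abs_rate_sub_le hp0 hp1 N k f).trans ?_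
  rw [Finset.sum_add_distrib, ← Finset.sum_div, Finset.sum_add_distrib]
  have h1 := sum_Ico_inv_sq_le N n
  have h2 := sum_dev_sq_le hf n
  have h3 := sum_Ico_zeta_le N n
  linarith

theorem sum_Ico_inv_le {N n : ℕ} (h : N ≤ n) :
    ∑ k ∈ Finset.Ico N n, 1 / ((k : ℝ) + 1) ≤ 1 + Real.log (((n : ℝ) + 2) / (N + 1)) := by
  have key : ∑ k ∈ Finset.Ico N (n + 1), 1 / ((k : ℝ) + 1) ≤
      1 / ((N : ℝ) + 1) + Real.log (((n : ℝ) + 1) / (N + 1)) := by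
    induction n, h using Nat.le_induction with
    | base => simp
    | succ n h ih =>
      rw [Finset.sum_Ico_succ_top (by omega)]
      have h1 := Real.one_sub_inv_le_log_of_pos
        (by positivity : (0 : ℝ) < ((n : ℝ) + 2) / (n + 1))
      have h2 : 1 - (((n : ℝ) + 2) / (n + 1))⁻¹ = 1 / (n + 2) := by field_simp; ring
      have h3 : Real.log (((n : ℝ) + 2) / (N + 1)) =
          Real.log (((n : ℝ) + 2) / (n + 1)) + Real.log (((n : ℝ) + 1) / (N + 1)) := by
        rw [← Real.log_mul (by positivity) (by positivity)]
        congr 1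
        field_simp
      push_cast
      rw [show (n : ℝ) + 1 + 1 = n + 2 by ring, h3]
      linarith
  rw [Finset.sum_Ico_succ_top h] at key
  have h4 : 1 / ((N : ℝ) + 1) ≤ 1 :=
    div_le_one_of_le₀ (by linarith [N.cast_nonneg (α := ℝ)]) (by positivity)
  have h5 : Real.log (((n : ℝ) + 1) / (N + 1)) ≤ Real.log (((n : ℝ) + 2) / (N + 1)) :=
    Real.log_le_log (by positivity) (by gcongr; norm_num)
  have h6 : 0 ≤ 1 / ((n : ℝ) + 1) := by positivity
  linarith

/-- From $1+x\le e^x$. The 3 is the 2 of `sum_abs_rate_sub_le` plus the 1 of the harmonic sum, as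
`expo p ≤ 1`; `N` enters only through $(N+1)^{-\gamma}$ and `devSum`. -/
theorem grow_le (hp0 : 0 < p) (hp1 : p < 1) {N n : ℕ} (h : N ≤ n) {f : ℕ → ℕ}
    (hf : devSum p N f ≠ ⊤) : grow p 1 f N n ≤ (((n : ℝ) + 2) / (N + 1)) ^ expo p *
      Real.exp (3 + ((devSum p N f).toReal + zetaSum) / 2) := by
  have h1 : grow p 1 f N n ≤ Real.exp (∑ k ∈ Finset.Ico N n, (1 - p) / wt f k) := by
    rw [Real.exp_sum]
    refine Finset.prod_le_prod (fun k _ => ?_) fun k _ => ?_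
    · linarith [rate_pos hp1 f k]
    · rw [one_mul, add_comm]; exact Real.add_one_le_exp _
  have h2 : ∑ k ∈ Finset.Ico N n, (1 - p) / wt f k ≤
      ∑ k ∈ Finset.Ico N n, |(1 - p) / wt f k - expo p / (k + 1)| +
        expo p * ∑ k ∈ Finset.Ico N n, 1 / ((k : ℝ) + 1) := by
    rw [Finset.mul_sum, ← Finset.sum_add_distrib]
    refine Finset.sum_le_sum fun k _ => ?_
    have := le_abs_self ((1 - p) / wt f k - expo p / (k + 1))
    rw [mul_one_div]
    linarith
  have h3 := sum_abs_rate_sub_le hp0 hp1 hf n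
  have h4 := sum_Ico_inv_le h
  have h5 : expo p ≤ 1 := by
    rw [expo, div_le_one (by linarith)]; linarith
  have h6 := mul_le_mul_of_nonneg_left h4 (expo_pos hp1).le
  have h7 : ∑ k ∈ Finset.Ico N n, (1 - p) / wt f k ≤ Real.log (((n : ℝ) + 2) / (N + 1)) * expo p +
      (3 + ((devSum p N f).toReal + zetaSum) / 2) := by nlinarith
  rw [Real.rpow_def_of_pos (by positivity), ← Real.exp_add]
  exact h1.trans (Real.exp_le_exp.2 h7)

theorem abs_log_one_add_sub_le {x : ℝ} (hx : 0 ≤ x) : |Real.log (1 + x) - x| ≤ x ^ 2 := by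
  have h1 := Real.log_le_sub_one_of_pos (by linarith : 0 < 1 + x)
  have h2 := Real.one_sub_inv_le_log_of_pos (by linarith : 0 < 1 + x)
  have h3 : x - x ^ 2 ≤ 1 - (1 + x)⁻¹ := by
    have : 1 - (1 + x)⁻¹ = x - x ^ 2 + x ^ 3 / (1 + x) := by field_simp; ring
    rw [this]
    have : 0 ≤ x ^ 3 / (1 + x) := by positivity
    linarith
  rw [abs_le]
  constructor <;> nlinarith

/-- The logarithm is $\gamma$ times a harmonic sum plus two absolutely convergent series: the error
in the rates and that of $\log(1+x)\approx x$. -/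
theorem tendsto_grow_div (hp0 : 0 < p) (hp1 : p < 1) {f : ℕ → ℕ} (hf : devSum p 0 f ≠ ⊤) :
    ∃ κ : ℝ, 0 < κ ∧ Tendsto (fun n : ℕ => grow p 1 f 0 n / ((n : ℝ) + 2) ^ expo p) atTop (𝓝 κ) := by
  have s1 : Summable fun k : ℕ => (1 - p) / wt f k - expo p / (k + 1) := by
    refine Summable.of_abs (summable_of_sum_range_le
      (c := 2 + ((devSum p 0 f).toReal + zetaSum) / 2) (fun k => abs_nonneg _) fun n => ?_)
    rw [Finset.range_eq_Ico]
    exact sum_abs_rate_sub_le hp0 hp1 hf n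
  have s2 : Summable fun k : ℕ => Real.log (1 + 1 * ((1 - p) / wt f k)) - (1 - p) / wt f k := by
    have h : Summable fun k : ℕ => 1 / ((k : ℝ) + 1) ^ 2 := by
      have := (summable_nat_add_iff 1).2 (Real.summable_one_div_nat_pow.2 (by norm_num : 1 < 2))
      simpa using this
    refine Summable.of_abs (h.of_nonneg_of_le (fun k => abs_nonneg _) fun k => ?_)
    rw [one_mul]
    refine (abs_log_one_add_sub_le (rate_pos hp1 f k).le).trans ?_
    rw [← one_div_pow]
    exact pow_le_pow_left₀ (rate_pos hp1 f k).le (rate_le hp0 f k) 2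
  have t3 : Tendsto (fun n : ℕ => (∑ k ∈ Finset.range n, 1 / ((k : ℝ) + 1)) -
      Real.log ((n : ℝ) + 2)) atTop (𝓝 (Real.eulerMascheroniConstant - 0)) := by
    have h1 := Real.tendsto_eulerMascheroniSeq
    have h2 : Tendsto (fun n : ℕ => Real.log ((n : ℝ) + 2) - Real.log ((n : ℝ) + 1)) atTop (𝓝 0) := by
      have := (Real.tendsto_log_nat_add_one_sub_log).comp (tendsto_add_atTop_nat 1)
      refine this.congr fun n => ?_
      simp only [Function.comp]
      push_cast
      rw [show (n : ℝ) + 1 + 1 = n + 2 by ring]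
    refine (h1.sub h2).congr fun n => ?_
    simp only [Real.eulerMascheroniSeq, harmonic]
    push_cast
    simp only [one_div]
    ring
  have t := (s1.hasSum.tendsto_sum_nat.add s2.hasSum.tendsto_sum_nat).add (t3.const_mul (expo p))
  refine ⟨_, Real.exp_pos _, ((Real.continuous_exp.tendsto _).comp t).congr fun n => ?_⟩
  have hg := grow_pos hp0 hp1 (by norm_num : (-1 : ℝ) < 1) f 0 n
  have hlog : Real.log (grow p 1 f 0 n) =
      ∑ k ∈ Finset.range n, Real.log (1 + 1 * ((1 - p) / wt f k)) := by
    rw [grow, ← Finset.range_eq_Ico, Real.log_prod]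
    exact fun k _ => (growFactor_pos hp0 hp1 (by norm_num) f k).ne'
  have : grow p 1 f 0 n / ((n : ℝ) + 2) ^ expo p =
      Real.exp (Real.log (grow p 1 f 0 n) - Real.log ((n : ℝ) + 2) * expo p) := by
    rw [Real.exp_sub, Real.exp_log hg, Real.rpow_def_of_pos (by positivity)]
  rw [this, hlog]
  simp only [Function.comp]
  congr 1
  rw [mul_sub, Finset.mul_sum, Finset.sum_sub_distrib, Finset.sum_sub_distrib]
  simp only [mul_one_div]
  ring

theorem ae_devSum_ne_top [IsProbabilityMeasure ν] (hν : IsPathLaw ν p) (hp0 : 0 < p)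
    (hp1 : p < 1) : ∀ᵐ f ∂ν, devSum p 0 f ≠ ⊤ := by
  have h := lintegral_devSum_le hν hp0 hp1 0
  have hz : zeroCyl 0 = Set.univ := by ext; simp [zeroCyl]
  rw [hz, setLIntegral_univ] at h
  filter_upwards [ae_lt_top (measurable_devSum p 0)
    (h.trans_lt (by simp)).ne] with f hf
  exact hf.ne

/-- The normalized maximal degree converges to a positive limit. -/
theorem ae_tendsto_pmax [IsProbabilityMeasure ν] (hν : IsPathLaw ν p) (hp0 : 0 < p)
    (hp1 : p < 1) : ∀ᵐ f ∂ν, ∃ c : ℝ, 0 < c ∧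
      Tendsto (fun n : ℕ => (pmax f n : ℝ) / ((n : ℝ) + 2) ^ expo p) atTop (𝓝 c) := by
  filter_upwards [ae_devSum_ne_top hν hp0 hp1, exists_tendsto_normMax hν hp0 hp1,
    not_tendsto_normMax_zero hν hp0 hp1] with f h1 ⟨c, h2⟩ h3
  obtain ⟨κ, hκ, h4⟩ := tendsto_grow_div hp0 hp1 h1
  have hc : 0 ≤ c := ge_of_tendsto' h2 fun n => normMax_nonneg hp1 n f
  have hc' : c ≠ 0 := fun h => h3 (h ▸ h2)
  refine ⟨c * κ, mul_pos (hc.lt_of_ne hc'.symm) hκ, (h2.mul h4).congr fun n => ?_⟩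
  have hg := grow_pos hp0 hp1 (by norm_num : (-1 : ℝ) < 1) f 0 n
  rw [normMax]
  field_simp

end

/-! ### Non-degeneracy: runs in which the superstar takes the first edges. -/

section

variable {p : ℝ} {ν : Measure (ℕ → ℕ)} {r : ℕ}

theorem pdeg_of_mem_zeroCyl {N : ℕ} {f : ℕ → ℕ} (hf : f ∈ zeroCyl N) {i : ℕ}
    (hi : i ∈ Finset.Ico 1 (N + 2)) : pdeg f N i = 1 := by
  obtain ⟨h1, h2⟩ := Finset.mem_Ico.1 hi
  induction N with
  | zero => simp only [pdeg]; rw [if_pos (by omega)]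
  | succ N ih =>
    have h0 : f N = 0 := hf N (by omega)
    simp only [pdeg, h0]
    rw [if_neg (by omega)]
    rcases Nat.lt_or_ge i (N + 2) with h | h
    · rw [ih (fun j hj => hf j (by omega)) (Finset.mem_Ico.2 ⟨h1, h⟩) h, if_neg (by omega)]
    · rw [pdeg_eq_zero f h, if_pos (by omega)]

theorem risingSum_of_mem_zeroCyl {N : ℕ} {f : ℕ → ℕ} (hf : f ∈ zeroCyl N) :
    risingSum p r N N f = r.factorial * (N + 1) := by
  rw [risingSum, Finset.sum_congr rfl fun i hi => by
    rw [pdeg_of_mem_zeroCyl hf hi, grow_self, Nat.one_ascFactorial]]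
  simp [mul_comm]

theorem lintegral_liminf_risingSum_le (hν : IsPathLaw ν p) (hp0 : 0 < p) (hp1 : p < 1)
    (hr : 4 ≤ r * (1 - p)) (N : ℕ) :
    ∫⁻ f in zeroCyl N, liminf (fun n => ENNReal.ofReal (risingSum p r N n f)) atTop ∂ν ≤
      ENNReal.ofReal (2 * (r.factorial * (N + 1))) * ν (zeroCyl N) := by
  have hms : MeasurableSet (zeroCyl N) := pathFiltration.le N _ (measurableSet_zero_cylinder N)
  refine (lintegral_liminf_le fun n => (depOn_risingSum p r N n).measurable.ennreal_ofReal).trans ?_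
  have h : ∀ᶠ n in atTop, ∫⁻ f in zeroCyl N, ENNReal.ofReal (risingSum p r N n f) ∂ν ≤
      ENNReal.ofReal (2 * (r.factorial * (N + 1))) * ν (zeroCyl N) := by
    filter_upwards [eventually_ge_atTop N] with n hn
    refine (lintegral_risingSum_le hν hp0 hp1 hr (measurableSet_zero_cylinder N) hn).trans
      (le_of_eq ?_)
    change ∫⁻ f in zeroCyl N, ENNReal.ofReal (risingSum p r N N f) ∂ν + _ * ν (zeroCyl N) = _
    rw [setLIntegral_congr_fun (g := fun _ => ENNReal.ofReal (r.factorial * (N + 1))) hms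
      fun f hf => by simp only [risingSum_of_mem_zeroCyl hf], setLIntegral_const, ← add_mul,
      ← ENNReal.ofReal_add (by positivity) (by positivity), two_mul]
  exact (liminf_le_liminf h).trans (by simp)

/-- Among the sequences that start with `N` zeros, there are some for which the rising factorial
moments and the deviations are both of the order of their means. -/
theorem exists_mem_zeroCyl [IsProbabilityMeasure ν] (hν : IsPathLaw ν p) (hp0 : 0 < p)
    (hp1 : p < 1) (hr : 4 ≤ r * (1 - p)) (N : ℕ) {P : (ℕ → ℕ) → Prop} (hP : ∀ᵐ f ∂ν, P f) :
    ∃ f ∈ zeroCyl N, P f ∧ devSum p N f ≤ ENNReal.ofReal (3 * zetaSum) ∧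
      ∃ᶠ n in atTop, risingSum p r N n f < 8 * (r.factorial * (N + 1)) := by
  set a : ℝ := 2 * (r.factorial * (N + 1)) with ha
  have ha0 : 0 < a := by have := r.factorial_pos; positivity
  have hms : MeasurableSet (zeroCyl N) := pathFiltration.le N _ (measurableSet_zero_cylinder N)
  have hpos : ν (zeroCyl N) ≠ 0 := (measure_cylinder_pos hν hp0 N).ne'
  set L : (ℕ → ℕ) → ENNReal := fun f =>
    liminf (fun n => ENNReal.ofReal (risingSum p r N n f)) atTop with hL
  have hLm : Measurable L :=
    Measurable.liminf fun n => (depOn_risingSum p r N n).measurable.ennreal_ofReal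
  -- On `zeroCyl N` each normalized summand has mean at most 1, so their sum cannot exceed 3 almost
  -- everywhere there.
  have hF : ∃ᵐ f ∂ν.restrict (zeroCyl N),
      L f / ENNReal.ofReal a + devSum p N f / ENNReal.ofReal zetaSum ≤ 3 := by
    intro hcon
    have h1 : ∫⁻ f in zeroCyl N, (L f / ENNReal.ofReal a + devSum p N f / ENNReal.ofReal zetaSum) ∂ν
        ≤ 2 * ν (zeroCyl N) := by
      simp only [div_eq_mul_inv]
      rw [lintegral_add_left (hLm.mul_const _), lintegral_mul_const _ hLm,
        lintegral_mul_const _ (measurable_devSum p N), two_mul]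
      simp only [← div_eq_mul_inv]
      refine add_le_add ?_ ?_
      · refine ENNReal.div_le_of_le_mul' (lintegral_liminf_risingSum_le hν hp0 hp1 hr N)
      · refine ENNReal.div_le_of_le_mul' (lintegral_devSum_le hν hp0 hp1 N)
    have h2 : 3 * ν (zeroCyl N) ≤ 2 * ν (zeroCyl N) := by
      rw [← setLIntegral_const]
      exact (lintegral_mono_ae (hcon.mono fun f hf => (not_le.1 hf).le)).trans h1
    have h3 := (ENNReal.mul_le_mul_iff_left hpos (measure_ne_top ν _)).1 h2
    norm_num at h3
  obtain ⟨f, h1, h2, h3⟩ :=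
    (hF.and_eventually ((ae_restrict_of_ae hP).and (ae_restrict_mem hms))).exists
  refine ⟨f, h3, h2, ?_, ?_⟩
  · have h4 := le_add_self.trans h1
    rw [ENNReal.div_le_iff (ENNReal.ofReal_pos.2 zetaSum_pos).ne' ENNReal.ofReal_ne_top] at h4
    rwa [ENNReal.ofReal_mul (by norm_num), ENNReal.ofReal_ofNat]
  · have h4 := le_self_add.trans h1
    rw [ENNReal.div_le_iff (ENNReal.ofReal_pos.2 ha0).ne' ENNReal.ofReal_ne_top,
      ← ENNReal.ofReal_ofNat, ← ENNReal.ofReal_mul (by norm_num)] at h4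
    -- Passing from 3 to 4 gives the strict inequality required for a frequent event;
    -- $4a=8\,r!\,(N+1)$.
    have h5 : L f < ENNReal.ofReal (4 * a) :=
      h4.trans_lt ((ENNReal.ofReal_lt_ofReal_iff (by positivity)).2 (by linarith))
    refine (frequently_lt_of_liminf_lt (by isBoundedDefault) h5).mono fun n hn => ?_
    have := (ENNReal.ofReal_lt_ofReal_iff (by positivity)).1 hn
    rw [ha] at this
    linarith

theorem not_ae_tendsto_const [IsProbabilityMeasure ν] (hν : IsPathLaw ν p) (hp0 : 0 < p)
    (hp1 : p < 1) {c : ℝ} (hc : 0 < c) :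
    ¬ ∀ᵐ f ∂ν, Tendsto (fun n : ℕ => (pmax f n : ℝ) / ((n : ℝ) + 2) ^ expo p) atTop (𝓝 c) := by
  intro hP
  obtain ⟨r, hr⟩ := exists_nat_ge (4 / (1 - p))
  rw [div_le_iff₀ (by linarith)] at hr
  have hγ : 2 ≤ expo p * r := by
    rw [expo, div_mul_eq_mul_div, le_div_iff₀ (by linarith)]
    linarith
  set E := Real.exp (3 + (3 * zetaSum + zetaSum) / 2) with hE
  -- For a run in `zeroCyl N`, $(c/2)^r\le 8\,r!\,(N+1)\,E^r/(N+1)^{\gamma r}$, and $\gamma r\ge2$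
  -- leaves a spare factor $N+1$.
  have key : ∀ N : ℕ, (c / 2) ^ r * (N + 1) ≤ 8 * r.factorial * E ^ r := by
    intro N
    obtain ⟨f, -, hf, hd, hfr⟩ := exists_mem_zeroCyl hν hp0 hp1 hr N hP
    have hdt : devSum p N f ≠ ⊤ := (hd.trans_lt ENNReal.ofReal_lt_top).ne
    have hdr : (devSum p N f).toReal ≤ 3 * zetaSum :=
      ENNReal.toReal_le_of_le_ofReal (by linarith [zetaSum_pos]) hd
    obtain ⟨n, hn1, hn2, hn3⟩ := (hfr.and_eventually
      ((hf.eventually_const_lt (half_lt_self hc)).and (eventually_ge_atTop N))).exists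
    have hg := grow_pos hp0 hp1 (by norm_num : (-1 : ℝ) < 1) f N n
    have hM : (0 : ℝ) < (N : ℝ) + 1 := by positivity
    have hgl : grow p 1 f N n ≤ (((n : ℝ) + 2) / (N + 1)) ^ expo p * E :=
      (grow_le hp0 hp1 hn3 hdt).trans (by
        rw [hE]; gcongr)
    have h1 : c / 2 ≤ (pmax f n : ℝ) / grow p 1 f N n * (E / ((N : ℝ) + 1) ^ expo p) := by
      refine hn2.le.trans ?_
      rw [Real.div_rpow (by positivity) hM.le] at hgl
      rw [div_mul_div_comm, div_le_div_iff₀ (by positivity) (by positivity)]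
      have h2 : grow p 1 f N n * ((N : ℝ) + 1) ^ expo p ≤ E * ((n : ℝ) + 2) ^ expo p := by
        refine (mul_le_mul_of_nonneg_right hgl (by positivity)).trans (le_of_eq ?_)
        field_simp
      calc (pmax f n : ℝ) * (grow p 1 f N n * ((N : ℝ) + 1) ^ expo p)
          ≤ pmax f n * (E * ((n : ℝ) + 2) ^ expo p) := by gcongr
        _ = _ := by ring
    have h3 : (c / 2) ^ r ≤ 8 * (r.factorial * (N + 1)) * (E ^ r / ((N : ℝ) + 1) ^ 2) := by
      refine (pow_le_pow_left₀ (by positivity) h1 r).trans ?_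
      rw [mul_pow, div_pow E]
      refine mul_le_mul ((pmax_div_grow_pow_le hp0 hp1 f N n).trans hn1.le) ?_ (by positivity)
        (by positivity)
      refine div_le_div_of_nonneg_left (by positivity) (by positivity) ?_
      rw [← Real.rpow_natCast (_ ^ expo p), ← Real.rpow_mul hM.le, ← Real.rpow_natCast _ 2]
      exact Real.rpow_le_rpow_of_exponent_le (by linarith [N.cast_nonneg (α := ℝ)])
        (by exact_mod_cast hγ)
    calc (c / 2) ^ r * (N + 1)
        ≤ 8 * (r.factorial * (N + 1)) * (E ^ r / ((N : ℝ) + 1) ^ 2) * (N + 1) := by gcongr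
      _ = 8 * r.factorial * E ^ r := by field_simp
  obtain ⟨N, hN⟩ := exists_nat_gt (8 * r.factorial * E ^ r / (c / 2) ^ r)
  have hc' : 0 < (c / 2) ^ r := by positivity
  rw [div_lt_iff₀ hc'] at hN
  have := key N
  nlinarith

end

/-! ### From the graph process to the parent sequence. -/

section

/-- The graph after `k` steps, when the vertex `v_{j+2}` attaches to `v_{f j}`. -/
def treeGraph (f : ℕ → ℕ) : ℕ → SimpleGraph ℕ
  | 0 => SimpleGraph.edge 0 1
  | k + 1 => treeGraph f k ⊔ SimpleGraph.edge (f k) (k + 2)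

theorem depOn_treeGraph (k : ℕ) : DepOn k fun f => treeGraph f k := by
  induction k with
  | zero => exact fun _ _ _ => rfl
  | succ k ih =>
    intro f g hfg
    have h : treeGraph f k = treeGraph g k := ih f g fun j hj => hfg j (by omega)
    simp only [treeGraph, h, hfg k (by omega)]

theorem treeGraph_adj_lt {f : ℕ → ℕ} {k : ℕ} (hf : ∀ j < k, f j < j + 2) {a b : ℕ}
    (h : (treeGraph f k).Adj a b) : a < k + 2 ∧ b < k + 2 := by
  induction k with
  | zero =>
    simp only [treeGraph, SimpleGraph.edge_adj] at h
    omega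
  | succ k ih =>
    simp only [treeGraph, SimpleGraph.sup_adj, SimpleGraph.edge_adj] at h
    have := hf k (by omega)
    rcases h with h | h
    · have := ih (fun j hj => hf j (by omega)) h
      omega
    · omega

theorem sup_edge_adj_iff {f : ℕ → ℕ} {k : ℕ} (hf : ∀ j < k, f j < j + 2) {i : ℕ} (hi : i < k + 2)
    (a : ℕ) : (treeGraph f k ⊔ SimpleGraph.edge i (k + 2)).Adj a (k + 2) ↔ a = i := by
  simp only [SimpleGraph.sup_adj, SimpleGraph.edge_adj]
  constructor
  · rintro (h | h)
    · have := treeGraph_adj_lt hf h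
      omega
    · omega
  · rintro rfl
    exact Or.inr ⟨Or.inl ⟨rfl, trivial⟩, by omega⟩

theorem vdeg_treeGraph {f : ℕ → ℕ} {k : ℕ} (hf : ∀ j < k, f j < j + 2) (v : ℕ) :
    vdeg (treeGraph f k) v = pdeg f k v := by
  induction k with
  | zero =>
    have h : ∀ w, (treeGraph f 0).Adj v w ↔ (v = 0 ∧ w = 1) ∨ (v = 1 ∧ w = 0) := fun w => by
      simp only [treeGraph, SimpleGraph.edge_adj]; omega
    unfold vdeg SimpleGraph.neighborSet pdeg
    simp only [h]
    rcases v with _ | _ | v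
    · simp
    · simp
    · simp
  | succ k ih =>
    have hf' : ∀ j < k, f j < j + 2 := fun j hj => hf j (by omega)
    have hk := hf k (by omega)
    have hfin : ((treeGraph f k).neighborSet v).Finite :=
      (Set.finite_Iio (k + 2)).subset fun w hw => (treeGraph_adj_lt hf' hw).2
    simp only [pdeg, ← ih hf']
    have hadj : ∀ w, w ∈ (treeGraph f (k + 1)).neighborSet v ↔ (treeGraph f k).Adj v w ∨
        (v = f k ∧ w = k + 2) ∨ (v = k + 2 ∧ w = f k) := fun w => by
      simp only [treeGraph, SimpleGraph.mem_neighborSet, SimpleGraph.sup_adj,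
        SimpleGraph.edge_adj]
      have : v = f k ∧ w = k + 2 ∨ v = k + 2 ∧ w = f k → v ≠ w := by omega
      tauto
    rcases eq_or_ne v (f k) with h | h
    · have hs : (treeGraph f (k + 1)).neighborSet v =
          insert (k + 2) ((treeGraph f k).neighborSet v) := by
        ext w
        rw [hadj, Set.mem_insert_iff, SimpleGraph.mem_neighborSet]
        have : v ≠ k + 2 := by omega
        tauto
      rw [if_pos ⟨h.symm, by omega⟩, if_neg (by omega), vdeg, hs, Set.ncard_insert_of_notMem _ hfin]
      · rfl
      · intro hw
        have := (treeGraph_adj_lt hf' hw).2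
        omega
    · rw [if_neg (by tauto)]
      rcases eq_or_ne v (k + 2) with h2 | h2
      · have hs : (treeGraph f (k + 1)).neighborSet v = {f k} := by
          ext w
          rw [hadj, Set.mem_singleton_iff]
          have : ¬ (treeGraph f k).Adj v w := fun hw => by
            have := (treeGraph_adj_lt hf' hw).1
            omega
          tauto
        rw [if_pos h2, ih hf', h2, pdeg_eq_zero f le_rfl, ← h2, vdeg, hs, Set.ncard_singleton]
      · have hs : (treeGraph f (k + 1)).neighborSet v = (treeGraph f k).neighborSet v := by
          ext w
          rw [hadj, SimpleGraph.mem_neighborSet]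
          tauto
        rw [if_neg h2, vdeg, hs]
        rfl

theorem maxDeg_treeGraph {f : ℕ → ℕ} {k : ℕ} (hf : ∀ j < k, f j < j + 2) :
    maxDeg (k + 2) (treeGraph f k) = pmax f k := by
  unfold maxDeg pmax
  exact Finset.sup_congr rfl fun i _ => vdeg_treeGraph hf i

theorem attachProb_treeGraph (p : ℝ) {f : ℕ → ℕ} {k : ℕ} (hf : ∀ j < k, f j < j + 2) (i : ℕ) :
    attachProb p (treeGraph f k) (k + 2) i = parentProb p f k i := by
  unfold attachProb parentProb wt
  simp only [vdeg_treeGraph hf]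
  push_cast
  rfl

/-- The graphs that arise after `k` steps. -/
def reachable (k : ℕ) : Set (SimpleGraph ℕ) := Set.range fun f => treeGraph f k

theorem countable_reachable (k : ℕ) : (reachable k).Countable := by
  have : reachable k ⊆ Set.range fun t : Fin k → ℕ => treeGraph (ext k t) k := by
    rintro _ ⟨f, rfl⟩
    exact ⟨res k f, depOn_treeGraph k _ _ fun j hj => ext_res f hj⟩
  exact (Set.countable_range _).mono this

open Classical in
/-- The parent of `v_{k+2}` in the graph `H`. -/
noncomputable def parentIn (k : ℕ) (H : SimpleGraph ℕ) : ℕ :=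
  if H ∈ reachable (k + 1) then sInf {i | H.Adj i (k + 2)} else 0

theorem parentIn_sup_edge {f : ℕ → ℕ} {k : ℕ} (hf : ∀ j < k, f j < j + 2) {i : ℕ}
    (hi : i < k + 2) : parentIn k (treeGraph f k ⊔ SimpleGraph.edge i (k + 2)) = i := by
  have hr : treeGraph f k ⊔ SimpleGraph.edge i (k + 2) ∈ reachable (k + 1) := by
    refine ⟨Function.update f k i, ?_⟩
    have h : treeGraph (Function.update f k i) k = treeGraph f k :=
      depOn_treeGraph k _ _ fun j hj => Function.update_of_ne hj.ne _ _
    simp only [treeGraph, h, Function.update_self]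
  rw [parentIn, if_pos hr]
  simp only [sup_edge_adj_iff hf hi]
  simp

/-- The history `G 1, G 2, …` given by the sequence `f` of parents. -/
def history (f : ℕ → ℕ) : ℕ → SimpleGraph ℕ
  | 0 => ⊥
  | 1 => ⊥
  | k + 2 => treeGraph f k

theorem forall_history_iff {Ω : Type*} {G : ℕ → Ω → SimpleGraph ℕ} {f : ℕ → ℕ} {k : ℕ} {ω : Ω} :
    (∀ n ∈ Finset.Icc 1 (k + 2), G n ω = history f n) ↔
      G 1 ω = ⊥ ∧ ∀ j ≤ k, G (j + 2) ω = treeGraph f j := by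
  constructor
  · intro h
    exact ⟨h 1 (by simp), fun j hj => h (j + 2) (Finset.mem_Icc.2 ⟨by omega, by omega⟩)⟩
  · rintro ⟨h1, h2⟩ n hn
    obtain ⟨ha, hb⟩ := Finset.mem_Icc.1 hn
    rcases n with _ | _ | n
    · omega
    · exact h1
    · exact h2 n (by omega)

variable {Ω : Type*} {G : ℕ → Ω → SimpleGraph ℕ}

/-- The parents of `v_2, v_3, …`. -/
noncomputable def parents (G : ℕ → Ω → SimpleGraph ℕ) (ω : Ω) (k : ℕ) : ℕ :=
  parentIn k (G (k + 3) ω)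

/-- Up to `k` steps the graphs are the ones given by the parents. -/
def FollowsParents (G : ℕ → Ω → SimpleGraph ℕ) (k : ℕ) (ω : Ω) : Prop :=
  G 1 ω = ⊥ ∧ (∀ j ≤ k, G (j + 2) ω = treeGraph (parents G ω) j) ∧ ∀ j < k, parents G ω j < j + 2

theorem FollowsParents.history_iff {f : ℕ → ℕ} {k : ℕ} {ω : Ω} (hω : FollowsParents G k ω)
    (hf : ∀ j < k, f j < j + 2) :
    (∀ n ∈ Finset.Icc 1 (k + 2), G n ω = history f n) ↔ ∀ j < k, parents G ω j = f j := by
  rw [forall_history_iff]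
  constructor
  · rintro ⟨-, h⟩ j hj
    have h1 : G (j + 3) ω = treeGraph f j ⊔ SimpleGraph.edge (f j) (j + 2) := h (j + 1) (by omega)
    rw [parents, h1, parentIn_sup_edge (fun i hi => hf i (by omega)) (hf j hj)]
  · intro h
    refine ⟨hω.1, fun j hj => (hω.2.1 j hj).trans ?_⟩
    exact depOn_treeGraph j _ _ fun i hi => h i (by omega)

variable [MeasurableSpace Ω] {μ : Measure Ω} {p : ℝ}

/-- Only events about single graphs are known to be measurable, hence preimages of countable sets of
graphs. This is why `parentIn` is constant off the countable set `reachable`. -/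
theorem measurable_parents (hG : ∀ (n : ℕ) (H : SimpleGraph ℕ), MeasurableSet {ω | G n ω = H}) :
    Measurable (parents G) := by
  refine measurable_pi_lambda _ fun k => measurable_to_countable' fun i => ?_
  have key : ∀ T : Set (SimpleGraph ℕ), T.Countable → MeasurableSet (G (k + 3) ⁻¹' T) := by
    intro T hT
    have : G (k + 3) ⁻¹' T = ⋃ H ∈ T, {ω | G (k + 3) ω = H} := by
      ext ω; simp
    rw [this]
    exact MeasurableSet.biUnion hT fun H _ => hG _ H
  -- The default value 0 makes this fibre possibly uncountable, so its complement is used.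
  rcases eq_or_ne i 0 with rfl | hi
  · have : (fun ω => parents G ω k) ⁻¹' {0} =
        (G (k + 3) ⁻¹' (reachable (k + 1) ∩ {H | parentIn k H ≠ 0}))ᶜ := by
      ext ω
      simp only [Set.mem_preimage, Set.mem_singleton_iff, parents, Set.mem_compl_iff,
        Set.mem_inter_iff, Set.mem_ofPred_eq, not_and, not_not]
      refine ⟨fun h _ => h, fun h => ?_⟩
      by_cases hr : G (k + 3) ω ∈ reachable (k + 1)
      · exact h hr
      · exact if_neg hr
    rw [this]
    exact (key _ ((countable_reachable _).mono Set.inter_subset_left)).compl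
  · have : (fun ω => parents G ω k) ⁻¹' {i} =
        G (k + 3) ⁻¹' (reachable (k + 1) ∩ {H | parentIn k H = i}) := by
      ext ω
      simp only [Set.mem_preimage, Set.mem_singleton_iff, parents,
        Set.mem_inter_iff, Set.mem_ofPred_eq]
      refine ⟨fun h => ⟨?_, h⟩, fun h => h.2⟩
      by_contra hr
      exact hi (h.symm.trans (if_neg hr))
    rw [this]
    exact key _ ((countable_reachable _).mono Set.inter_subset_left)

theorem measurableSet_history (hG : IsSuperstarProcess μ p G) (f : ℕ → ℕ) (k : ℕ) :
    MeasurableSet {ω | ∀ n ∈ Finset.Icc 1 (k + 2), G n ω = history f n} := by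
  have : {ω | ∀ n ∈ Finset.Icc 1 (k + 2), G n ω = history f n} =
      ⋂ n ∈ Finset.Icc 1 (k + 2), {ω | G n ω = history f n} := by
    ext ω; simp
  rw [this]
  exact Finset.measurableSet_biInter _ fun n _ => hG.measurableSet_eq n _

variable [IsProbabilityMeasure μ]

/-- The attachment events are disjoint, as the parent can be read off the graph, and their
conditional probabilities sum to 1, so they exhaust the history event up to a null set. -/
theorem ae_exists_parent (hG : IsSuperstarProcess μ p G) (hp0 : 0 < p) (hp1 : p < 1)
    {f : ℕ → ℕ} {k : ℕ} (hf : ∀ j < k, f j < j + 2) :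
    ∀ᵐ ω ∂μ, (∀ n ∈ Finset.Icc 1 (k + 2), G n ω = history f n) →
      ∃ i < k + 2, G (k + 3) ω = treeGraph f k ⊔ SimpleGraph.edge i (k + 2) := by
  set E := {ω | ∀ n ∈ Finset.Icc 1 (k + 2), G n ω = history f n} with hE
  set F : ℕ → Set Ω := fun i => {ω | (∀ n ∈ Finset.Icc 1 (k + 2), G n ω = history f n) ∧
    G (k + 2 + 1) ω = history f (k + 2) ⊔ SimpleGraph.edge i (k + 2)} with hF
  have hFm : ∀ i, MeasurableSet (F i) := fun i =>
    (measurableSet_history hG f k).inter (hG.measurableSet_eq _ _)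
  have hd : Set.PairwiseDisjoint (↑(Finset.range (k + 2))) F := by
    intro i hi j hj hij
    refine Set.disjoint_left.2 fun ω h1 h2 => hij ?_
    have h3 := h1.2.symm.trans h2.2
    rw [← parentIn_sup_edge hf (Finset.mem_range.1 (Finset.mem_coe.1 hi)),
      ← parentIn_sup_edge hf (Finset.mem_range.1 (Finset.mem_coe.1 hj))]
    exact congrArg (parentIn k) h3
  have hμ : μ (⋃ i ∈ Finset.range (k + 2), F i) = μ E := by
    rw [measure_biUnion_finset hd fun i _ => hFm i, Finset.sum_congr rfl fun i hi =>
      hG.step (k + 2) (by omega) (history f) i (Finset.mem_range.1 hi), ← Finset.sum_mul]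
    simp only [history, attachProb_treeGraph p hf]
    rw [← ENNReal.ofReal_sum_of_nonneg fun i _ => parentProb_nonneg hp0 hp1 f k i,
      sum_parentProb, ENNReal.ofReal_one, one_mul]
    rfl
  have hsub : (⋃ i ∈ Finset.range (k + 2), F i) ⊆ E := by
    intro ω hω
    simp only [Set.mem_iUnion] at hω
    obtain ⟨i, _, h⟩ := hω
    exact h.1
  have hae := ae_eq_of_subset_of_measure_ge hsub hμ.ge
    (Finset.measurableSet_biUnion _ fun i _ => hFm i).nullMeasurableSet (measure_ne_top μ E)
  filter_upwards [hae.mem_iff] with ω hω h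
  have h1 := hω.2 h
  simp only [Set.mem_iUnion] at h1
  obtain ⟨i, hi, h2⟩ := h1
  exact ⟨i, Finset.mem_range.1 hi, h2.2⟩

theorem ae_followsParents (hG : IsSuperstarProcess μ p G) (hp0 : 0 < p) (hp1 : p < 1) (k : ℕ) :
    ∀ᵐ ω ∂μ, FollowsParents G k ω := by
  induction k with
  | zero =>
    filter_upwards [hG.init_one, hG.init_two] with ω h1 h2
    refine ⟨h1, fun j hj => ?_, fun j hj => absurd hj (Nat.not_lt_zero j)⟩
    obtain rfl : j = 0 := by omega
    exact h2
  | succ k ih =>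
    -- Histories are indexed by countably many finite sequences, so one null set serves them all.
    have h : ∀ᵐ ω ∂μ, ∀ t : Fin k → ℕ, (∀ j < k, ext k t j < j + 2) →
        (∀ n ∈ Finset.Icc 1 (k + 2), G n ω = history (ext k t) n) →
          ∃ i < k + 2, G (k + 3) ω = treeGraph (ext k t) k ⊔ SimpleGraph.edge i (k + 2) :=
      ae_all_iff.2 fun t => by
        by_cases ht : ∀ j < k, ext k t j < j + 2
        · exact (ae_exists_parent hG hp0 hp1 ht).mono fun ω hω _ => hω
        · exact ae_of_all _ fun ω h => absurd h ht
    filter_upwards [ih, h] with ω h1 h2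
    have e : ∀ j < k, ext k (res k (parents G ω)) j = parents G ω j := fun j hj => ext_res _ hj
    have hv : ∀ j < k, ext k (res k (parents G ω)) j < j + 2 := fun j hj => by
      rw [e j hj]; exact h1.2.2 j hj
    obtain ⟨i, hi, h3⟩ := h2 (res k (parents G ω)) hv
      ((h1.history_iff hv).2 fun j hj => (e j hj).symm)
    have h4 : parents G ω k = i := by rw [parents, h3, parentIn_sup_edge hv hi]
    have h5 : treeGraph (ext k (res k (parents G ω))) k = treeGraph (parents G ω) k :=
      depOn_treeGraph k _ _ e
    refine ⟨h1.1, fun j hj => ?_, fun j hj => ?_⟩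
    · rcases Nat.lt_or_ge k j with hkj | hkj
      · obtain rfl : j = k + 1 := by omega
        rw [treeGraph, h4, ← h5]
        exact h3
      · exact h1.2.1 j hkj
    · rcases Nat.lt_or_ge j k with hkj | hkj
      · exact h1.2.2 j hkj
      · obtain rfl : j = k := by omega
        rw [h4]
        exact hi

theorem isPathLaw_map_parents (hG : IsSuperstarProcess μ p G) (hp0 : 0 < p) (hp1 : p < 1) :
    IsPathLaw (μ.map (parents G)) p := by
  have hX := measurable_parents hG.measurableSet_eq
  have hms : ∀ k (f : ℕ → ℕ) i, MeasurableSet {g : ℕ → ℕ | (∀ j < k, g j = f j) ∧ g k = i} :=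
    fun k f i => (measurableSet_cylinder k f).inter
      (measurableSet_eq_fun (measurable_pi_apply k) measurable_const)
  have hfol := ae_all_iff.2 (ae_followsParents hG hp0 hp1)
  constructor
  · rw [ae_map_iff hX.aemeasurable]
    · filter_upwards [hfol] with ω hω k
      exact (hω (k + 1)).2.2 k (by omega)
    · have : {f : ℕ → ℕ | ∀ k, f k < k + 2} = ⋂ k, {f | f k < k + 2} := by ext; simp
      rw [this]
      exact MeasurableSet.iInter fun k =>
        measurableSet_lt (measurable_pi_apply k) measurable_const
  · intro k f i hi
    rw [Measure.map_apply hX (hms k f i), Measure.map_apply hX (measurableSet_cylinder k f)]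
    by_cases hf : ∀ j < k, f j < j + 2
    · have h := hG.step (k + 2) (by omega) (history f) i hi
      rw [show history f (k + 2) = treeGraph f k from rfl, attachProb_treeGraph p hf] at h
      have e1 : parents G ⁻¹' {g | ∀ j < k, g j = f j} =ᵐ[μ]
          {ω | ∀ n ∈ Finset.Icc 1 (k + 2), G n ω = history f n} := by
        filter_upwards [hfol] with ω hω
        exact propext ((hω k).history_iff hf).symm
      have e2 : parents G ⁻¹' {g | (∀ j < k, g j = f j) ∧ g k = i} =ᵐ[μ]
          {ω | (∀ n ∈ Finset.Icc 1 (k + 2), G n ω = history f n) ∧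
            G (k + 2 + 1) ω = treeGraph f k ⊔ SimpleGraph.edge i (k + 2)} := by
        filter_upwards [hfol] with ω hω
        refine propext ((and_congr_left' ((hω k).history_iff hf).symm).trans
          (and_congr_right fun hh => ?_))
        have h1 : treeGraph (parents G ω) k = treeGraph f k :=
          depOn_treeGraph k _ _ (((hω k).history_iff hf).1 hh)
        have h2 : G (k + 2 + 1) ω = treeGraph f k ⊔ SimpleGraph.edge (parents G ω k) (k + 2) := by
          rw [← h1]; exact (hω (k + 1)).2.1 (k + 1) le_rfl
        constructor
        · rintro rfl
          exact h2
        · intro h3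
          exact (congrArg (parentIn k) h3).trans (parentIn_sup_edge hf hi)
      rw [measure_congr e1, measure_congr e2, h]
    -- An impossible prefix, with a parent not yet born: both sides vanish.
    · have h0 : μ (parents G ⁻¹' {g | ∀ j < k, g j = f j}) = 0 := by
        rw [measure_eq_zero_iff_ae_notMem]
        filter_upwards [hfol] with ω hω h
        exact hf fun j hj => by rw [← h j hj]; exact (hω k).2.2 j hj
      rw [h0, mul_zero]
      exact measure_mono_null (fun ω hω => hω.1) h0

end

end Superstar

theorem mainTheorem2 {Ω : Type*} [MeasurableSpace Ω] (μ : Measure Ω) [IsProbabilityMeasure μ]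
    (p : ℝ) (hp0 : 0 < p) (hp1 : p < 1) (G : ℕ → Ω → SimpleGraph ℕ)
    (hG : Superstar.IsSuperstarProcess μ p G) :
    ∃ Δ : Ω → ℝ, Measurable Δ ∧ (∀ᵐ ω ∂μ, 0 < Δ ω) ∧
      (¬ ∃ c : ℝ, ∀ᵐ ω ∂μ, Δ ω = c) ∧
      ∀ᵐ ω ∂μ, Tendsto
        (fun n : ℕ => (Superstar.maxDeg n (G n ω) : ℝ) / (n : ℝ) ^ ((1 - p) / (2 - p)))
        atTop (𝓝 (Δ ω)) := by
  have hX := Superstar.measurable_parents hG.measurableSet_eq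
  have hν := Superstar.isPathLaw_map_parents hG hp0 hp1
  have : IsProbabilityMeasure (μ.map (Superstar.parents G)) :=
    Measure.isProbabilityMeasure_map hX.aemeasurable
  have hlim := Superstar.ae_tendsto_pmax hν hp0 hp1
  have hm : ∀ n : ℕ, Measurable fun f : ℕ → ℕ =>
      (Superstar.pmax f n : ℝ) / ((n : ℝ) + 2) ^ Superstar.expo p := fun n =>
    ((Superstar.depOn_pmax n).comp fun d => (d : ℝ) / ((n : ℝ) + 2) ^ Superstar.expo p).measurable
  obtain ⟨D, hD, hDlim⟩ := measurable_limit_of_tendsto_metrizable_ae (fun n => (hm n).aemeasurable)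
    (hlim.mono fun f ⟨c, _, hc⟩ => ⟨c, hc⟩)
  have hDpos : ∀ᵐ f ∂μ.map (Superstar.parents G), 0 < D f := by
    filter_upwards [hlim, hDlim] with f ⟨c, hc0, hc⟩ h
    rwa [tendsto_nhds_unique h hc]
  refine ⟨D ∘ Superstar.parents G, hD.comp hX, ae_of_ae_map hX.aemeasurable hDpos, ?_, ?_⟩
  · rintro ⟨c, hc⟩
    have hc' : ∀ᵐ f ∂μ.map (Superstar.parents G), D f = c :=
      (ae_map_iff hX.aemeasurable (measurableSet_eq_fun hD measurable_const)).2 hc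
    obtain ⟨f, h1, h2⟩ := (hDpos.and hc').exists
    refine Superstar.not_ae_tendsto_const hν hp0 hp1 (h2 ▸ h1) ?_
    filter_upwards [hDlim, hc'] with f h3 h4
    rwa [h4] at h3
  · filter_upwards [ae_of_ae_map hX.aemeasurable hDlim,
      ae_all_iff.2 (Superstar.ae_followsParents hG hp0 hp1)] with ω h1 h2
    -- `G (n + 2)` is the tree after `n` steps, which explains the normalization by $(n+2)^\gamma$.
    rw [← tendsto_add_atTop_iff_nat 2]
    refine h1.congr fun n => ?_
    rw [(h2 n).2.1 n le_rfl, Superstar.maxDeg_treeGraph (h2 n).2.2]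
    push_cast
    rfl
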